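/- Consider a two-armed Gaussian bandit with horizon $n\ge 1$: in each round $t=1,\dots,n$ a strategy chooses an arm $I_t\in\{1,2\}$ as a (measurable, possibly randomised) function of the past choices and rewards, and receives a reward $X_t\sim\mathcal N(\mu_{I_t},1)$, where $\mu=(\mu_1,\mu_2)$ is the unknown vector of means. Put $\mu^*=\max\{\mu_1,\mu_2\}$. Let $\nu_1,\nu_2\in\mathbb R$ and $\sigma_1^2,\sigma_2^2\ge 0$, and let $Q=\mathcal N(\nu_1,\sigma_1^2)\otimes\mathcal N(\nu_2,\sigma_2^2)$ be the Gaussian prior on $\mathbb R^2$ with mean $\nu$ and covariance matrix $\operatorname{diag}(\sigma_1^2,\sigma_2^2)$. A strategy is called Bayes optimal if it minimises the Bayesian regret $$\mathbb E_{\theta\sim Q}\left[\mathbb E\left[\sum_{t=1}^n(\mu^*-\mu_{I_t})\,\middle|\,\mu=\theta\right]\right]$$ among all strategies. For $\nu\in\mathbb R$, $\sigma^2\ge 0$ and $m\ge 1$ let $\mu\sim\mathcal N(\nu,\sigma^2)$ be a real random variable and, conditionally on it, let $Y_1,\dots,Y_m$ be independent with law $\mathcal N(\mu,1)$. The finite-horizon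 Gittins index is $$\gamma(\nu,\sigma^2,m)=\max\left\{\gamma\in\mathbb R:\ \sup_{1\le\tau\le m}\mathbb E[(\mu-\gamma)\tau]\ge 0\right\},$$ where the supremum is over the stopping times $\tau$, $1\le\tau\le m$, of the filtration generated by $Y_1,\dots,Y_m$. Theorem. There is a universal constant $c>0$ such that for all $n\ge1$, $\nu_1,\nu_2\in\mathbb R$ and $\sigma_1^2,\sigma_2^2\ge0$: if some Bayes-optimal strategy chooses arm $1$ in the first round (with positive probability, if it is randomised), then $$\nu_1+\sqrt{2c\,\sigma_1^2\log n}\ \ge\ \gamma(\nu_2,\sigma_2^2,n).$$ -/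

import Mathlib

open MeasureTheory ProbabilityTheory
open scoped NNReal

noncomputable section

namespace Bandit

/-! ### The Gaussian bandit -/

/-- The law of an i.i.d. sequence of standard Gaussian variables (the reward noise). -/
def noise : Measure (ℕ → ℝ) := Measure.infinitePi fun _ : ℕ => gaussianReal 0 1

instance : IsProbabilityMeasure noise := by unfold noise; infer_instance

/-- A (possibly randomised) strategy for the `d`-armed bandit. Rounds are counted from `0`: the arm
chosen in round `t` is a measurable function of the arms chosen and the rewards received in
rounds `0, …, t - 1`, and of a random seed in `[0, 1]`, drawn once, uniformly and independently of
everything else. A deterministic strategy is one that ignores the seed. -/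
structure Strategy (d : ℕ) where
  act : (t : ℕ) → unitInterval → (Fin t → Fin d × ℝ) → Fin d
  measurable_act : ∀ t, Measurable fun p : unitInterval × (Fin t → Fin d × ℝ) => act t p.1 p.2

namespace Strategy

variable {d : ℕ}

/-- The arms chosen and the rewards received before round `t`, when the seed is `u`, the vector of
means is `μ` and the noise is `ε`: choosing arm `i` in round `s` yields the reward `μ i + ε s`. -/
def history (π : Strategy d) (u : unitInterval) (μ : Fin d → ℝ) (ε : ℕ → ℝ) :
    (t : ℕ) → Fin t → Fin d × ℝ
  | 0 => Fin.elim0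
  | t + 1 =>
    Fin.snoc (history π u μ ε t)
      (π.act t u (history π u μ ε t), μ (π.act t u (history π u μ ε t)) + ε t)

/-- The arm chosen in round `t` (rounds counted from `0`). -/
def arm (π : Strategy d) (u : unitInterval) (μ : Fin d → ℝ) (ε : ℕ → ℝ) (t : ℕ) : Fin d :=
  π.act t u (π.history u μ ε t)

/-- The expected regret of `π` over `n` rounds when the vector of means is `μ`. -/
def regret (π : Strategy d) (n : ℕ) (μ : Fin d → ℝ) : ℝ :=
  ∫ p : unitInterval × (ℕ → ℝ),
    ∑ t ∈ Finset.range n, ((⨆ i, μ i) - μ (π.arm p.1 μ p.2 t))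
      ∂((volume : Measure unitInterval).prod noise)

/-- The Bayesian regret of `π` over `n` rounds under the prior `Q` on the vector of means. -/
def bayesRegret (π : Strategy d) (n : ℕ) (Q : Measure (Fin d → ℝ)) : ℝ :=
  ∫ θ, π.regret n θ ∂Q

/-- `π` minimises the Bayesian regret over `n` rounds among all strategies. -/
def IsBayesOptimal (π : Strategy d) (n : ℕ) (Q : Measure (Fin d → ℝ)) : Prop :=
  ∀ π' : Strategy d, π.bayesRegret n Q ≤ π'.bayesRegret n Q

/-- The probability that `π` chooses arm `i` in the first round. -/
def probFirst (π : Strategy d) (i : Fin d) : ENNReal :=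
  (volume : Measure unitInterval) {u | π.act 0 u Fin.elim0 = i}

end Strategy

/-- The Gaussian prior with mean `ν` and diagonal covariance matrix `diag v`. -/
def gaussianPrior {d : ℕ} (ν : Fin d → ℝ) (v : Fin d → ℝ≥0) : Measure (Fin d → ℝ) :=
  Measure.pi fun i => gaussianReal (ν i) (v i)

/-! ### The finite-horizon Gittins index -/

/-- The joint law of an unknown mean `μ ∼ N(ν, v)` and an independent noise sequence `ε`. -/
def armLaw (ν : ℝ) (v : ℝ≥0) : Measure (ℝ × (ℕ → ℝ)) := (gaussianReal ν v).prod noise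

instance (ν : ℝ) (v : ℝ≥0) : IsProbabilityMeasure (armLaw ν v) := by unfold armLaw; infer_instance

/-- The first `t` observations `μ + ε 0, …, μ + ε (t - 1)`, each `N(μ, 1)`-distributed given `μ`. -/
def obs (t : ℕ) (ω : ℝ × (ℕ → ℝ)) : Fin t → ℝ := fun s => ω.1 + ω.2 s

/-- Stopping times `1 ≤ τ ≤ m`: the event `τ = t` is measurable with respect to the `σ`-algebra
generated by the first `t` observations. -/
structure IsStoppingRule (m : ℕ) (τ : ℝ × (ℕ → ℝ) → ℕ) : Prop where
  one_le : ∀ ω, 1 ≤ τ ω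
  le : ∀ ω, τ ω ≤ m
  measurableSet_eq : ∀ t, MeasurableSet[MeasurableSpace.comap (obs t) inferInstance] {ω | τ ω = t}

/-- The supremum of `E[(μ - γ) τ]` over all stopping times `1 ≤ τ ≤ m`. -/
def stoppingValue (ν : ℝ) (v : ℝ≥0) (m : ℕ) (γ : ℝ) : ℝ :=
  ⨆ τ : {τ // IsStoppingRule m τ}, ∫ ω, (ω.1 - γ) * (τ.1 ω : ℝ) ∂(armLaw ν v)

/-- The Gittins index of an arm with prior mean `ν`, prior variance `v` and horizon `m`: the
greatest `γ` for which the value of the stopping problem is nonnegative. For `m ≥ 1` the supremum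
is attained, see `isGreatest_gittinsIndex`. -/
def gittinsIndex (ν : ℝ) (v : ℝ≥0) (m : ℕ) : ℝ := sSup {γ | 0 ≤ stoppingValue ν v m γ}

theorem measurable_obs (t : ℕ) : Measurable (obs t) := by
  unfold obs; fun_prop

theorem IsStoppingRule.measurable {m : ℕ} {τ : ℝ × (ℕ → ℝ) → ℕ} (h : IsStoppingRule m τ) :
    Measurable τ :=
  measurable_to_countable' fun t => (measurable_obs t).comap_le _ (h.measurableSet_eq t)

theorem isStoppingRule_one {m : ℕ} (hm : 1 ≤ m) : IsStoppingRule m fun _ => 1 where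
  one_le _ := le_rfl
  le _ := hm
  measurableSet_eq _ := MeasurableSet.const _

theorem isGreatest_aux {ι : Type*} [Nonempty ι] (a b : ι → ℝ) (A M : ℝ) (ha : ∀ i, |a i| ≤ A)
    (hb : ∀ i, 1 ≤ b i) (hM : ∀ i, b i ≤ M) :
    IsGreatest {γ | 0 ≤ ⨆ i, (a i - γ * b i)} (⨆ i, a i / b i) := by
  have hA : 0 ≤ A := (abs_nonneg _).trans (ha (Classical.arbitrary ι))
  have hM1 : 1 ≤ M := (hb (Classical.arbitrary ι)).trans (hM _)
  have bdd : BddAbove (Set.range fun i => a i / b i) := by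
    refine ⟨A, ?_⟩
    rintro _ ⟨i, rfl⟩
    have := hb i
    have h2 := (abs_le.1 (ha i)).2
    rw [div_le_iff₀ (by linarith)]
    nlinarith
  have bdd' : ∀ γ, BddAbove (Set.range fun i => a i - γ * b i) := by
    intro γ
    refine ⟨A + |γ| * M, ?_⟩
    rintro _ ⟨i, rfl⟩
    have h1 := hb i
    have h2 := (abs_le.1 (ha i)).2
    have h3 : -|γ| ≤ γ := neg_abs_le γ
    have h4 := mul_le_mul_of_nonneg_left (hM i) (abs_nonneg γ)
    have h5 : -γ * b i ≤ |γ| * b i := by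
      apply mul_le_mul_of_nonneg_right _ (by linarith); linarith
    simp only
    linarith
  constructor
  · show (0 : ℝ) ≤ ⨆ i, (a i - (⨆ i, a i / b i) * b i)
    refine le_of_forall_pos_le_add fun e he => ?_
    obtain ⟨i, hi⟩ := exists_lt_of_lt_ciSup
      (show (⨆ i, a i / b i) - e / M < ⨆ i, a i / b i by
        have : 0 < e / M := by positivity
        linarith)
    have hbi : 0 < b i := by linarith [hb i]
    rw [lt_div_iff₀ hbi] at hi
    have h1 : e / M * b i ≤ e := by
      rw [div_mul_eq_mul_div, div_le_iff₀ (by linarith)]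
      exact mul_le_mul_of_nonneg_left (hM i) he.le
    have h2 := le_ciSup (bdd' (⨆ i, a i / b i)) i
    linarith
  · intro γ hγ
    refine le_of_forall_pos_le_add fun e he => ?_
    obtain ⟨i, hi⟩ := exists_lt_of_lt_ciSup (lt_of_lt_of_le (neg_lt_zero.2 he) hγ)
    have hbi : 0 < b i := by linarith [hb i]
    have h1 : γ - e ≤ a i / b i := by
      rw [le_div_iff₀ hbi]
      nlinarith [hb i]
    linarith [le_ciSup bdd i]

/-- The supremum that defines the Gittins index is a maximum. -/
theorem isGreatest_gittinsIndex (ν : ℝ) (v : ℝ≥0) {m : ℕ} (hm : 1 ≤ m) :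
    IsGreatest {γ | 0 ≤ stoppingValue ν v m γ} (gittinsIndex ν v m) := by
  have : Nonempty {τ // IsStoppingRule m τ} := ⟨⟨_, isStoppingRule_one hm⟩⟩
  have hμ : Integrable (fun ω : ℝ × (ℕ → ℝ) => ω.1) (armLaw ν v) := by
    have : Integrable (fun x : ℝ => x) (gaussianReal ν v) :=
      (memLp_id_gaussianReal 1).integrable le_rfl
    exact this.comp_fst _
  have hτ : ∀ τ : {τ // IsStoppingRule m τ}, Measurable fun ω => (τ.1 ω : ℝ) := fun τ =>
    measurable_from_top.comp τ.2.measurable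
  have hle : ∀ (τ : {τ // IsStoppingRule m τ}) ω, (τ.1 ω : ℝ) ≤ m := fun τ ω => by
    exact_mod_cast τ.2.le ω
  have hge : ∀ (τ : {τ // IsStoppingRule m τ}) ω, 1 ≤ (τ.1 ω : ℝ) := fun τ ω => by
    exact_mod_cast τ.2.one_le ω
  have hnorm : ∀ (τ : {τ // IsStoppingRule m τ}) ω, ‖(τ.1 ω : ℝ)‖ ≤ m := fun τ ω => by
    simpa using hle τ ω
  have hτi : ∀ τ : {τ // IsStoppingRule m τ}, Integrable (fun ω => (τ.1 ω : ℝ)) (armLaw ν v) :=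
    fun τ => Integrable.of_bound (hτ τ).aestronglyMeasurable m (Filter.Eventually.of_forall (hnorm τ))
  have hμτ : ∀ τ : {τ // IsStoppingRule m τ},
      Integrable (fun ω => ω.1 * (τ.1 ω : ℝ)) (armLaw ν v) :=
    fun τ => hμ.mul_bdd (hτ τ).aestronglyMeasurable (Filter.Eventually.of_forall (hnorm τ))
  have key := isGreatest_aux (fun τ : {τ // IsStoppingRule m τ} => ∫ ω, ω.1 * (τ.1 ω : ℝ) ∂(armLaw ν v))
    (fun τ => ∫ ω, (τ.1 ω : ℝ) ∂(armLaw ν v)) (∫ ω, |ω.1| * m ∂(armLaw ν v)) m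
    (fun τ => by
      refine (abs_integral_le_integral_abs).trans (integral_mono (hμτ τ).abs (hμ.abs.mul_const _) ?_)
      intro ω
      simp only [abs_mul]
      exact mul_le_mul_of_nonneg_left (hnorm τ ω) (abs_nonneg _))
    (fun τ => by simpa using integral_mono (integrable_const (1 : ℝ)) (hτi τ) (hge τ))
    (fun τ => by simpa using integral_mono (hτi τ) (integrable_const (m : ℝ)) (hle τ))
  have hval : ∀ γ, stoppingValue ν v m γ = ⨆ τ : {τ // IsStoppingRule m τ},
      ((∫ ω, ω.1 * (τ.1 ω : ℝ) ∂(armLaw ν v)) - γ * ∫ ω, (τ.1 ω : ℝ) ∂(armLaw ν v)) := by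
    intro γ
    unfold stoppingValue
    congr 1
    ext τ
    rw [← integral_const_mul, ← integral_sub (hμτ τ) ((hτi τ).const_mul γ)]
    congr 1
    ext ω
    ring
  unfold gittinsIndex
  simp only [hval]
  rw [key.csSup_eq]
  exact key

end Bandit

end

/-! Arms are numbered 0 and 1 here. Let `G` be the Gittins index of arm 1, and suppose that `G`
exceeds `ν 0 + √(2c v₀ log n)` although `π` starts with arm 0 with positive probability. A strictly
better strategy is then built, contradicting optimality.

Let `T` be a nearly optimal stopping rule for arm 1 at level `G`. On the seeds where `π` starts with
arm 0, the new strategy pulls arm 1 until `T` and then imitates `π`, reusing the stored rewards of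
arm 1. If `π` pulls arm 1 `N` times, the new strategy does so `max N T` times
(`pulls_exploreFirst`), so `D = T - min T N` pulls move from arm 0 to arm 1 and the regret drops by
`E[(μ₁ - μ₀) D]`. This is `E[(μ₁ - G) T] - E[(μ₁ - G) min T N] + E[(G - μ₀) D]`, with `T` set to 0
on the other seeds. The first term is nearly nonnegative. The second expectation is at most 0: given
the seed and the data of arm 0, `min T N` is a stopping rule for arm 1. As `π` starts with arm 0, `N
< n`, so `D ≥ 1` when `T = n`; by independence of the arms the third term is at least, per unit of
seed probability, `(G - ν₀) P(T = n) - (n - 1) E[(μ₀ - G)⁺]` (`le_integral_extraPulls`).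

It remains to compare these two quantities. The Gaussian tail is polynomially small in `n`, with an
exponent governed by `c`. Conversely `P(T = n)` is at least a constant times `n⁻³` uniformly in the
prior (`exists_isRule_le_measureReal`): stopping before `n` brings almost no gain, because one more
observation would double-count it, so the deficit `ν - G` of the compulsory first pull must be
recovered on `{T = n}`. Cauchy–Schwarz turns this into a bound on the probability, and testing the
index with a two-stage rule bounds `G - ν` below on the same scale in `v`.

Both arguments need rewards indexed by arm and pull number, whereas the model indexes the noise by
rounds; `map_history_eq` shows that the two descriptions give the same law of the history. -/

noncomputable section

namespace Bandit

/-! ### Fresh coordinates of an i.i.d. family -/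

section Fresh

variable {J : Type*} [DecidableEq J]

/-- The law of a family of independent standard Gaussian variables indexed by `J`. -/
def iidGaussian (J : Type*) : Measure (J → ℝ) := Measure.infinitePi fun _ : J => gaussianReal 0 1

instance (J : Type*) : IsProbabilityMeasure (iidGaussian J) := by
  unfold iidGaussian; infer_instance

/-- Resampling one coordinate preserves an i.i.d. law; this is the source of all the fresh
randomness below. -/
theorem measurePreserving_update (j : J) :
    MeasurePreserving (fun p : (J → ℝ) × ℝ => Function.update p.1 j p.2)
      ((iidGaussian J).prod (gaussianReal 0 1)) (iidGaussian J) := by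
  have hm : Measurable (fun p : (J → ℝ) × ℝ => Function.update p.1 j p.2) := by
    refine measurable_pi_lambda _ fun i => ?_
    by_cases h : i = j
    · subst h; simpa using measurable_snd
    · simp only [Function.update_of_ne h]
      exact (measurable_pi_apply i).comp measurable_fst
  refine ⟨hm, Measure.eq_infinitePi _ fun s t ht => ?_⟩
  rw [Measure.map_apply hm (MeasurableSet.pi s.countable_toSet fun i _ => ht i)]
  by_cases hj : j ∈ s
  · have : (fun p : (J → ℝ) × ℝ => Function.update p.1 j p.2) ⁻¹' (Set.pi s t) =
        (Set.pi (s.erase j) t) ×ˢ t j := by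
      ext p
      simp only [Set.mem_preimage, Set.mem_pi, Set.mem_prod, Finset.coe_erase, Set.mem_sdiff,
        Finset.mem_coe, Set.mem_singleton_iff]
      constructor
      · intro h
        refine ⟨fun i hi => ?_, by simpa using h j hj⟩
        have := h i hi.1
        rwa [Function.update_of_ne hi.2] at this
      · rintro ⟨h1, h2⟩ i hi
        by_cases hij : i = j
        · subst hij; simpa using h2
        · rw [Function.update_of_ne hij]; exact h1 i ⟨hi, hij⟩
    rw [this, Measure.prod_prod, iidGaussian, Measure.infinitePi_pi _ (fun i _ => ht i), mul_comm,
      ← Finset.mul_prod_erase s _ hj]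
  · have : (fun p : (J → ℝ) × ℝ => Function.update p.1 j p.2) ⁻¹' (Set.pi s t) =
        (Set.pi s t) ×ˢ Set.univ := by
      ext p
      simp only [Set.mem_preimage, Set.mem_pi, Set.mem_prod, Finset.mem_coe, Set.mem_univ,
        and_true]
      refine forall₂_congr fun i hi => ?_
      rw [Function.update_of_ne (by rintro rfl; exact hj hi)]
    rw [this, Measure.prod_prod, iidGaussian, Measure.infinitePi_pi _ (fun i _ => ht i)]
    simp

/-- A coordinate chosen by a statistic that does not depend on it is independent of this
statistic and standard Gaussian. -/
theorem map_fresh [Countable J] {E : Type*} [MeasurableSpace E] {H : (J → ℝ) → E}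
    (hH : Measurable H) {j : E → J} (hj : ∀ i, MeasurableSet {h | j h = i})
    (hfresh : ∀ x z, H (Function.update x (j (H x)) z) = H x) :
    (iidGaussian J).map (fun x => (H x, x (j (H x)))) =
      ((iidGaussian J).map H).prod (gaussianReal 0 1) := by
  have hmx : Measurable fun x : J → ℝ => x (j (H x)) := by
    intro t ht
    have : (fun x : J → ℝ => x (j (H x))) ⁻¹' t =
        ⋃ i, (H ⁻¹' {h | j h = i}) ∩ ((fun x => x i) ⁻¹' t) := by
      ext x; simp
    rw [this]
    exact MeasurableSet.iUnion fun i => (hH (hj i)).inter (measurable_pi_apply i ht)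
  have : IsProbabilityMeasure ((iidGaussian J).map H) :=
    Measure.isProbabilityMeasure_map hH.aemeasurable
  refine (Measure.prod_eq fun s t hs ht => ?_).symm
  rw [Measure.map_apply (hH.prodMk hmx) (hs.prod ht), Measure.map_apply hH hs]
  -- Split according to the selected coordinate. By freshness, membership in `B i` does not depend
  -- on coordinate `i`, which can therefore be resampled independently on that piece.
  let B : J → Set (J → ℝ) := fun i => H ⁻¹' (s ∩ {h | j h = i})
  have hB : ∀ i, MeasurableSet (B i) := fun i => hH (hs.inter (hj i))
  have hinv : ∀ i x z, Function.update x i z ∈ B i ↔ x ∈ B i := by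
    have key : ∀ i x z, x ∈ B i → Function.update x i z ∈ B i := by
      rintro i x z ⟨h1, h2⟩
      have h2 : j (H x) = i := h2
      have := hfresh x z
      rw [h2] at this
      exact ⟨by rw [this]; exact h1, by show j _ = i; rw [this, h2]⟩
    refine fun i x z => ⟨fun h => ?_, key i x z⟩
    simpa using key i _ (x i) h
  have hdisj : Pairwise (Function.onFun Disjoint B) := by
    intro a b hab
    refine Set.disjoint_left.2 fun x hx hy => hab ?_
    exact (show j (H x) = a from hx.2).symm.trans hy.2
  have e1 : (fun x : J → ℝ => (H x, x (j (H x)))) ⁻¹' (s ×ˢ t) =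
      ⋃ i, B i ∩ (fun x => x i) ⁻¹' t := by
    ext x; simp [B]
  have e2 : H ⁻¹' s = ⋃ i, B i := by
    ext x; simp [B]
  rw [e1, e2, measure_iUnion hdisj hB, ← ENNReal.tsum_mul_right,
    measure_iUnion (fun a b hab => (hdisj hab).mono Set.inter_subset_left Set.inter_subset_left)
      (fun i => (hB i).inter (measurable_pi_apply i ht))]
  refine tsum_congr fun i => ?_
  rw [← (measurePreserving_update i).measure_preimage
    ((hB i).inter (measurable_pi_apply i ht)).nullMeasurableSet, ← Measure.prod_prod]
  congr 1
  ext ⟨x, z⟩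
  simp [hinv]

end Fresh

/-! ### Reward tables -/

/-- The number of pulls of arm `i` in a history. -/
def pulls {d : ℕ} : (t : ℕ) → (Fin t → Fin d × ℝ) → Fin d → ℕ
  | 0, _, _ => 0
  | t + 1, h, i => pulls t (Fin.init h) i + if (h (Fin.last t)).1 = i then 1 else 0

/-- The table of the rewards in a history; entries that have not been observed are `0`. -/
def tableOf {d : ℕ} : (t : ℕ) → (Fin t → Fin d × ℝ) → Fin d → ℕ → ℝ
  | 0, _, _, _ => 0
  | t + 1, h, i, k =>
    if (h (Fin.last t)).1 = i ∧ pulls t (Fin.init h) i = k then (h (Fin.last t)).2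
    else tableOf t (Fin.init h) i k

theorem measurable_init {d t : ℕ} :
    Measurable fun h : Fin (t + 1) → Fin d × ℝ => (Fin.init h : Fin t → Fin d × ℝ) :=
  measurable_pi_lambda _ fun _ => measurable_pi_apply _

theorem measurable_pulls {d : ℕ} (t : ℕ) (i : Fin d) :
    Measurable fun h : Fin t → Fin d × ℝ => pulls t h i := by
  induction t with
  | zero => exact measurable_const
  | succ t ih =>
    unfold pulls
    refine (ih.comp measurable_init).add (Measurable.ite ?_ measurable_const measurable_const)
    exact (measurable_pi_apply (Fin.last t)).fst (measurableSet_singleton i)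

theorem measurable_tableOf {d : ℕ} (t : ℕ) :
    Measurable fun h : Fin t → Fin d × ℝ => tableOf t h := by
  refine measurable_pi_lambda _ fun i => measurable_pi_lambda _ fun k => ?_
  induction t with
  | zero => exact measurable_const
  | succ t ih =>
    unfold tableOf
    refine Measurable.ite (MeasurableSet.inter ?_ ?_)
      (measurable_pi_apply (Fin.last t)).snd (ih.comp measurable_init)
    · exact (measurable_pi_apply (Fin.last t)).fst (measurableSet_singleton i)
    · exact (measurable_pulls t i).comp measurable_init (measurableSet_singleton k)

theorem measurable_snoc {α β : Type*} [MeasurableSpace α] [MeasurableSpace β] {t : ℕ}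
    {f : α → Fin t → β} {g : α → β} (hf : Measurable f) (hg : Measurable g) :
    Measurable fun a => (Fin.snoc (f a) (g a) : Fin (t + 1) → β) := by
  refine measurable_pi_lambda _ fun i => ?_
  refine Fin.lastCases ?_ (fun i => ?_) i
  · simpa using hg
  · simp only [Fin.snoc_castSucc]
    exact (measurable_pi_apply i).comp hf

@[simp] theorem pulls_snoc {d t : ℕ} (h : Fin t → Fin d × ℝ) (p : Fin d × ℝ) (i : Fin d) :
    pulls (t + 1) (Fin.snoc h p) i = pulls t h i + if p.1 = i then 1 else 0 := by
  simp [pulls]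

@[simp] theorem tableOf_snoc {d t : ℕ} (h : Fin t → Fin d × ℝ) (p : Fin d × ℝ) (i : Fin d)
    (k : ℕ) : tableOf (t + 1) (Fin.snoc h p) i k =
      if p.1 = i ∧ pulls t h i = k then p.2 else tableOf t h i k := by
  simp [tableOf]

theorem pulls_zero_add_pulls_one (t : ℕ) (h : Fin t → Fin 2 × ℝ) :
    pulls t h 0 + pulls t h 1 = t := by
  induction t with
  | zero => rfl
  | succ t ih =>
    have := ih (Fin.init h)
    rcases Fin.exists_fin_two.1 ⟨(h (Fin.last t)).1, rfl⟩ with h1 | h1 <;>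
      simp only [pulls, h1] <;> simp <;> omega

namespace Strategy

variable {d : ℕ}

/-- The history before round `t` when the `k`-th pull of arm `i` yields the reward `r i k`. -/
def tableHistory (π : Strategy d) (u : unitInterval) (r : Fin d → ℕ → ℝ) :
    (t : ℕ) → Fin t → Fin d × ℝ
  | 0 => Fin.elim0
  | t + 1 =>
    Fin.snoc (tableHistory π u r t)
      (π.act t u (tableHistory π u r t),
        r (π.act t u (tableHistory π u r t))
          (pulls t (tableHistory π u r t) (π.act t u (tableHistory π u r t))))

theorem measurable_act_uncurry {α : Type*} [MeasurableSpace α] (π : Strategy d) (t : ℕ)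
    {f : α → unitInterval} {g : α → Fin t → Fin d × ℝ} (hf : Measurable f) (hg : Measurable g) :
    Measurable fun a => π.act t (f a) (g a) :=
  (π.measurable_act t).comp (hf.prodMk hg)

theorem measurable_history (π : Strategy d) (t : ℕ) :
    Measurable fun p : unitInterval × (Fin d → ℝ) × (ℕ → ℝ) =>
      π.history p.1 p.2.1 p.2.2 t := by
  induction t with
  | zero => exact measurable_const
  | succ t ih =>
    unfold history
    have ha := π.measurable_act_uncurry t measurable_fst ih
    refine measurable_snoc ih (ha.prodMk (Measurable.add ?_ ?_))
    · have : Measurable fun q : Fin d × (Fin d → ℝ) => q.2 q.1 :=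
        measurable_from_prod_countable_right fun i => measurable_pi_apply i
      exact this.comp (ha.prodMk measurable_snd.fst)
    · exact (measurable_pi_apply t).comp measurable_snd.snd

theorem measurable_tableHistory (π : Strategy d) (t : ℕ) :
    Measurable fun p : unitInterval × (Fin d → ℕ → ℝ) => π.tableHistory p.1 p.2 t := by
  induction t with
  | zero => exact measurable_const
  | succ t ih =>
    unfold tableHistory
    have ha := π.measurable_act_uncurry t measurable_fst ih
    refine measurable_snoc ih (ha.prodMk ?_)
    have h1 : Measurable fun q : (Fin d × ℕ) × (Fin d → ℕ → ℝ) => q.2 q.1.1 q.1.2 :=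
      measurable_from_prod_countable_right fun i =>
        (measurable_pi_apply i.2).comp (measurable_pi_apply i.1)
    have h2 : Measurable fun q : Fin d × (Fin t → Fin d × ℝ) => pulls t q.2 q.1 :=
      measurable_from_prod_countable_right fun i => measurable_pulls t i
    exact h1.comp ((ha.prodMk (h2.comp (ha.prodMk ih))).prodMk measurable_snd)

/-- A strategy only depends on the entries of the table that it has observed. -/
theorem tableHistory_congr (π : Strategy d) (u : unitInterval) {r r' : Fin d → ℕ → ℝ} (t : ℕ)
    (h : ∀ i k, k < pulls t (π.tableHistory u r t) i → r i k = r' i k) :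
    π.tableHistory u r' t = π.tableHistory u r t := by
  induction t with
  | zero => rfl
  | succ t ih =>
    have h0 := ih fun i k hk => h i k (by rw [tableHistory, pulls_snoc]; omega)
    simp only [tableHistory, h0]
    congr 2
    refine (h _ _ ?_).symm
    simp [tableHistory]

theorem history_congr (π : Strategy d) (u : unitInterval) (θ : Fin d → ℝ) {ε ε' : ℕ → ℝ} (t : ℕ)
    (h : ∀ k < t, ε k = ε' k) : π.history u θ ε' t = π.history u θ ε t := by
  induction t with
  | zero => rfl
  | succ t ih =>
    have h0 := ih fun k hk => h k (by omega)
    simp only [history, h0, h t (by omega)]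

/-- The history of a strategy has the same law whether the noise is indexed by the rounds or by
the pulls of the arms. -/
theorem map_history_eq (π : Strategy d) (u : unitInterval) (θ : Fin d → ℝ) (t : ℕ) :
    noise.map (fun ε => π.history u θ ε t) =
      (iidGaussian (Fin d × ℕ)).map
        (fun x => π.tableHistory u (fun i k => θ i + x (i, k)) t) := by
  have m1 : ∀ t, Measurable fun ε => π.history u θ ε t := fun t =>
    (π.measurable_history t).comp (measurable_const.prodMk (measurable_const.prodMk measurable_id))
  have m2 : ∀ t, Measurable fun x : Fin d × ℕ → ℝ =>
      π.tableHistory u (fun i k => θ i + x (i, k)) t := fun t =>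
    (π.measurable_tableHistory t).comp (measurable_const.prodMk
      (measurable_pi_lambda _ fun i => measurable_pi_lambda _ fun k =>
        (measurable_pi_apply (i, k)).const_add _))
  induction t with
  | zero =>
    have e1 : (fun ε => π.history u θ ε 0) = fun _ => Fin.elim0 := rfl
    have e2 : (fun x : Fin d × ℕ → ℝ => π.tableHistory u (fun i k => θ i + x (i, k)) 0) =
      fun _ => Fin.elim0 := rfl
    rw [e1, e2, Measure.map_const, Measure.map_const]
    simp
  | succ t ih =>
    have ma : Measurable fun h => π.act t u h :=
      π.measurable_act_uncurry t measurable_const measurable_id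
    -- In both models the next history is the same function `g` of the current history and an
    -- independent standard Gaussian: the noise of round `t`, or the first unused table entry of the
    -- chosen arm.
    let g : (Fin t → Fin d × ℝ) × ℝ → Fin (t + 1) → Fin d × ℝ := fun p =>
      Fin.snoc p.1 (π.act t u p.1, θ (π.act t u p.1) + p.2)
    have mg : Measurable g := by
      refine measurable_snoc measurable_fst ((ma.comp measurable_fst).prodMk
        (Measurable.add ?_ measurable_snd))
      exact (measurable_from_top (f := θ)).comp (ma.comp measurable_fst)
    have f1 : noise.map (fun ε => (π.history u θ ε t, ε t)) =
        (noise.map fun ε => π.history u θ ε t).prod (gaussianReal 0 1) := by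
      refine map_fresh (J := ℕ) (m1 t) (j := fun _ => t) (fun i => MeasurableSet.const _) ?_
      intro x z
      refine π.history_congr u θ t fun k hk => ?_
      rw [Function.update_of_ne hk.ne]
    have f2 := map_fresh (J := Fin d × ℕ) (m2 t)
      (j := fun h => (π.act t u h, pulls t h (π.act t u h))) (fun i => by
        have h2 : Measurable fun q : Fin d × (Fin t → Fin d × ℝ) => pulls t q.2 q.1 :=
          measurable_from_prod_countable_right fun i => measurable_pulls t i
        exact (ma.prodMk (h2.comp (ma.prodMk measurable_id))) (measurableSet_singleton i)) (by
        intro x z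
        refine π.tableHistory_congr u t fun i k hk => ?_
        rw [Function.update_of_ne]
        intro h
        obtain ⟨rfl, rfl⟩ := Prod.mk.inj h
        exact lt_irrefl _ hk)
    have mpair1 : Measurable fun ε : ℕ → ℝ => (π.history u θ ε t, ε t) :=
      (m1 t).prodMk (measurable_pi_apply t)
    calc noise.map (fun ε => π.history u θ ε (t + 1))
        = (noise.map (fun ε => (π.history u θ ε t, ε t))).map g := by
          rw [Measure.map_map mg mpair1]; rfl
      _ = _ := by
          rw [f1, ih, ← f2, Measure.map_map mg]
          · rfl
          · refine (m2 t).prodMk ?_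
            have h1 : Measurable fun q : (Fin d × ℕ) × (Fin d × ℕ → ℝ) => q.2 q.1 :=
              measurable_from_prod_countable_right fun i => measurable_pi_apply i
            have h2 : Measurable fun q : Fin d × (Fin t → Fin d × ℝ) => pulls t q.2 q.1 :=
              measurable_from_prod_countable_right fun i => measurable_pulls t i
            have h3 := ma.comp (m2 t)
            exact h1.comp ((h3.prodMk (h2.comp (h3.prodMk (m2 t)))).prodMk measurable_id)

end Strategy

/-! ### Exploring an arm first -/

namespace Strategy

variable {d : ℕ}

theorem pulls_tableHistory_succ (π : Strategy d) (u : unitInterval) (r : Fin d → ℕ → ℝ) (t : ℕ)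
    (i : Fin d) : pulls (t + 1) (π.tableHistory u r (t + 1)) i =
      pulls t (π.tableHistory u r t) i +
        if π.act t u (π.tableHistory u r t) = i then 1 else 0 := by
  simp [tableHistory]

theorem monotone_pulls_tableHistory (π : Strategy d) (u : unitInterval) (r : Fin d → ℕ → ℝ)
    (i : Fin d) : Monotone fun t => pulls t (π.tableHistory u r t) i :=
  monotone_nat_of_le_succ fun t => by
    rw [pulls_tableHistory_succ]; omega

theorem pulls_tableHistory_le (π : Strategy d) (u : unitInterval) (r : Fin d → ℕ → ℝ) (t : ℕ)
    (i : Fin d) : pulls t (π.tableHistory u r t) i ≤ t := by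
  induction t with
  | zero => simp [pulls]
  | succ t ih => rw [pulls_tableHistory_succ]; split_ifs <;> omega

theorem tableOf_tableHistory (π : Strategy d) (u : unitInterval) (r : Fin d → ℕ → ℝ) (t : ℕ)
    {i : Fin d} {k : ℕ} (hk : k < pulls t (π.tableHistory u r t) i) :
    tableOf t (π.tableHistory u r t) i k = r i k := by
  induction t with
  | zero => simp [pulls] at hk
  | succ t ih =>
    rw [pulls_tableHistory_succ] at hk
    rw [tableHistory, tableOf_snoc]
    split_ifs with h
    · obtain ⟨rfl, rfl⟩ := h
      rfl
    · refine ih ?_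
      split_ifs at hk with h1
      · have : pulls t (π.tableHistory u r t) i ≠ k := fun h2 => h ⟨h1, h2⟩
        omega
      · simpa using hk

/-- The arm that `π` chooses in round `t` after moving `T` pulls of arm `1` to the front. -/
def exploreArm (π : Strategy 2) (T : unitInterval → (ℕ → ℝ) → ℕ) (t : ℕ) (u : unitInterval)
    (r : Fin 2 → ℕ → ℝ) : Fin 2 :=
  if t < T u (r 1) ∨
    (π.act t u (π.tableHistory u r t) = 1 ∧ T u (r 1) ≤ pulls t (π.tableHistory u r t) 1)
  then 1 else 0

theorem measurable_exploreArm (π : Strategy 2) {T : unitInterval → (ℕ → ℝ) → ℕ}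
    (hT : Measurable fun p : unitInterval × (ℕ → ℝ) => T p.1 p.2) (t : ℕ) :
    Measurable fun p : unitInterval × (Fin 2 → ℕ → ℝ) => π.exploreArm T t p.1 p.2 := by
  have h1 : Measurable fun p : unitInterval × (Fin 2 → ℕ → ℝ) => T p.1 (p.2 1) :=
    hT.comp (measurable_fst.prodMk ((measurable_pi_apply 1).comp measurable_snd))
  have h2 := π.measurable_tableHistory t
  unfold exploreArm
  refine Measurable.ite (MeasurableSet.union ?_ (MeasurableSet.inter ?_ ?_))
    measurable_const measurable_const
  · exact measurableSet_lt measurable_const h1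
  · exact π.measurable_act_uncurry t measurable_fst h2 (measurableSet_singleton 1)
  · exact measurableSet_le h1 ((measurable_pulls t 1).comp h2)

/-- The strategy that pulls arm `1` until the stopping time `T` and then imitates `π`, using the
rewards already received instead of pulling arm `1` as long as possible. -/
def exploreFirst (π : Strategy 2) (T : unitInterval → (ℕ → ℝ) → ℕ)
    (hT : Measurable fun p : unitInterval × (ℕ → ℝ) => T p.1 p.2) : Strategy 2 where
  act t u h := π.exploreArm T t u (tableOf t h)
  measurable_act t := (π.measurable_exploreArm hT t).comp
    (measurable_fst.prodMk ((measurable_tableOf t).comp measurable_snd))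

/-- `T` only depends on the first `T` observations. -/
def NonAnticipating (T : (ℕ → ℝ) → ℕ) : Prop :=
  ∀ y y', (∀ k < T y, y k = y' k) → T y' = T y

/-- The modified strategy is implementable: its decision uses only the table entries that it will
have observed, `max N (min t T)` from arm 1 and the rest of the `t` rounds from arm 0. The
unobserved entries, filled with 0 by `tableOf`, are harmless. -/
theorem exploreArm_congr (π : Strategy 2) {T : unitInterval → (ℕ → ℝ) → ℕ} {u : unitInterval}
    (hT : NonAnticipating (T u)) {t : ℕ} {r r' : Fin 2 → ℕ → ℝ}
    (h1 : ∀ k < max (pulls t (π.tableHistory u r t) 1) (min t (T u (r 1))), r 1 k = r' 1 k)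
    (h0 : ∀ k < t - max (pulls t (π.tableHistory u r t) 1) (min t (T u (r 1))),
      r 0 k = r' 0 k) :
    π.exploreArm T t u r' = π.exploreArm T t u r := by
  by_cases ht : t < T u (r 1)
  · have : t < T u (r' 1) := by
      by_contra hlt
      have := hT (r' 1) (r 1) fun k hk => (h1 k (lt_max_of_lt_right (by omega))).symm
      omega
    simp [exploreArm, ht, this]
  have hT' : T u (r' 1) = T u (r 1) := hT _ _ fun k hk => h1 k (lt_max_of_lt_right (by omega))
  have hsum := pulls_zero_add_pulls_one t (π.tableHistory u r t)
  by_cases hg : T u (r 1) ≤ pulls t (π.tableHistory u r t) 1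
  · have : π.tableHistory u r' t = π.tableHistory u r t := by
      refine π.tableHistory_congr u t (Fin.forall_fin_two.2 ⟨fun k hk => ?_, fun k hk => ?_⟩)
      · exact h0 k (by omega)
      · exact h1 k (by omega)
    simp only [exploreArm, hT', this]
  -- Here the history of `π` may involve unobserved rewards of arm 0, but the decision is 0 as long
  -- as `π` has made fewer than `T` pulls of arm 1, so only this inequality must be checked under
  -- `r'`. Otherwise let `s` be the first time at which `π` on `r'` reaches `T` pulls of arm 1. Up
  -- to `s` it reads `T` entries of arm 1 and at most `t - T` of arm 0, all common to both tables;
  -- so `π` on `r` would reach `T` as well.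
  · have hg' : ¬ T u (r 1) ≤ pulls t (π.tableHistory u r' t) 1 := by
      intro hcon
      have hex : ∃ s, T u (r 1) ≤ pulls s (π.tableHistory u r' s) 1 := ⟨t, hcon⟩
      obtain ⟨s, hs, hmin⟩ : ∃ s, T u (r 1) ≤ pulls s (π.tableHistory u r' s) 1 ∧
          ∀ s' < s, pulls s' (π.tableHistory u r' s') 1 < T u (r 1) :=
        ⟨Nat.find hex, Nat.find_spec hex, fun s' h => not_le.1 (Nat.find_min hex h)⟩
      have hst : s ≤ t := by
        by_contra hlt
        have := hmin t (by omega)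
        omega
      have hs' : pulls s (π.tableHistory u r' s) 1 ≤ T u (r 1) := by
        cases s with
        | zero => simp [pulls]
        | succ s =>
          have := hmin s (by omega)
          rw [pulls_tableHistory_succ]
          split_ifs <;> omega
      have hm0 := π.monotone_pulls_tableHistory u r' 0 hst
      have hsum' := pulls_zero_add_pulls_one t (π.tableHistory u r' t)
      simp only at hm0
      have : π.tableHistory u r s = π.tableHistory u r' s := by
        refine π.tableHistory_congr u s (Fin.forall_fin_two.2 ⟨fun k hk => ?_, fun k hk => ?_⟩)
        · exact (h0 k (by omega)).symm
        · exact (h1 k (by omega)).symm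
      have hm := π.monotone_pulls_tableHistory u r 1 hst
      simp only [this] at hm
      omega
    simp [exploreArm, ht, hT', hg, hg']

/-- After the exploration the count of arm 1 stays at `T` until the imitated `π` catches up with it,
and then both counts move together. -/
theorem pulls_exploreFirst (π : Strategy 2) {T : unitInterval → (ℕ → ℝ) → ℕ}
    (hTm : Measurable fun p : unitInterval × (ℕ → ℝ) => T p.1 p.2) {u : unitInterval}
    (hT : NonAnticipating (T u)) (r : Fin 2 → ℕ → ℝ) (t : ℕ) :
    pulls t ((π.exploreFirst T hTm).tableHistory u r t) 1 =
      max (pulls t (π.tableHistory u r t) 1) (min t (T u (r 1))) := by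
  induction t with
  | zero => simp [pulls]
  | succ t ih =>
    set σ := π.exploreFirst T hTm
    have hsum := pulls_zero_add_pulls_one t (σ.tableHistory u r t)
    have hact : σ.act t u (σ.tableHistory u r t) = π.exploreArm T t u r := by
      refine π.exploreArm_congr hT (fun k hk => ?_) fun k hk => ?_
      · exact (σ.tableOf_tableHistory u r t (by omega)).symm
      · exact (σ.tableOf_tableHistory u r t (by omega)).symm
    have hle := π.pulls_tableHistory_le u r t 1
    rw [pulls_tableHistory_succ, pulls_tableHistory_succ, ih, hact, exploreArm]
    by_cases ht : t < T u (r 1)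
    · simp only [ht, true_or, if_true]
      split_ifs <;> omega
    · by_cases ha : π.act t u (π.tableHistory u r t) = 1
      · by_cases hg : T u (r 1) ≤ pulls t (π.tableHistory u r t) 1
        · simp [ht, ha, hg]; omega
        · simp [ht, ha, hg]; omega
      · simp [ht, ha]; omega

end Strategy

/-- Measurability with respect to the first `t` observations makes `{τ = t}` a preimage under `obs
t`, so it cannot separate points with equal observations. -/
theorem IsStoppingRule.eq_of_eqOn {m : ℕ} {τ : ℝ × (ℕ → ℝ) → ℕ} (h : IsStoppingRule m τ)
    {ω ω' : ℝ × (ℕ → ℝ)} (hω : ∀ k < τ ω, ω.1 + ω.2 k = ω'.1 + ω'.2 k) : τ ω' = τ ω := by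
  obtain ⟨s, -, hs⟩ := h.measurableSet_eq (τ ω)
  have h1 : ω ∈ obs (τ ω) ⁻¹' s := by rw [hs]; rfl
  have h2 : ω' ∈ obs (τ ω) ⁻¹' s := by
    have : obs (τ ω) ω' = obs (τ ω) ω := funext fun k => (hω k k.2).symm
    rw [Set.mem_preimage, this]; exact h1
  rw [hs] at h2
  exact h2

theorem IsStoppingRule.nonAnticipating {m : ℕ} {τ : ℝ × (ℕ → ℝ) → ℕ} (h : IsStoppingRule m τ) :
    Strategy.NonAnticipating fun y => τ (0, y) := fun _ _ hy =>
  h.eq_of_eqOn fun k hk => by simpa using hy k hk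

theorem IsStoppingRule.apply_eq {m : ℕ} {τ : ℝ × (ℕ → ℝ) → ℕ} (h : IsStoppingRule m τ)
    (ω : ℝ × (ℕ → ℝ)) : τ (0, fun k => ω.1 + ω.2 k) = τ ω :=
  h.eq_of_eqOn fun k _ => by simp

/-- A measurable nonanticipating function of the observations is a stopping time. -/
theorem isStoppingRule_of_nonAnticipating {m : ℕ} {T : (ℕ → ℝ) → ℕ} (hTm : Measurable T)
    (hT : Strategy.NonAnticipating T) (h1 : ∀ y, 1 ≤ T y) (hm : ∀ y, T y ≤ m) :
    IsStoppingRule m fun ω => T fun k => ω.1 + ω.2 k where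
  one_le _ := h1 _
  le _ := hm _
  measurableSet_eq t := by
    -- Padding by zeros makes `T` a measurable function of finitely many observations;
    -- nonanticipation makes the padding irrelevant to the event `T = t`.
    let pad : (Fin t → ℝ) → ℕ → ℝ := fun z k => if hk : k < t then z ⟨k, hk⟩ else 0
    have hpad : Measurable pad := measurable_pi_lambda _ fun k => by
      by_cases hk : k < t
      · simpa [pad, hk] using measurable_pi_apply _
      · simp [pad, hk]
    refine ⟨{z | T (pad z) = t}, (hTm.comp hpad) (measurableSet_singleton t), ?_⟩
    ext ω
    have hk : ∀ k < t, pad (obs t ω) k = ω.1 + ω.2 k := fun k hk => by simp [pad, hk, obs]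
    simp only [Set.mem_preimage, Set.mem_ofPred_eq]
    exact ⟨fun h => (hT _ _ fun k hk' => hk k (hk'.trans_eq h)).trans h,
      fun h => (hT _ _ fun k hk' => (hk k (hk'.trans_eq h)).symm).trans h⟩

/-! ### Gaussian estimates for a single arm -/

section Arm

variable (ν : ℝ) (v : ℝ≥0)

theorem map_fst_armLaw : (armLaw ν v).map Prod.fst = gaussianReal ν v := by
  simp [armLaw, Measure.map_fst_prod]

theorem map_snd_armLaw : (armLaw ν v).map Prod.snd = noise := by
  simp [armLaw, Measure.map_snd_prod]

theorem map_noise_armLaw (k : ℕ) : (armLaw ν v).map (fun ω => ω.2 k) = gaussianReal 0 1 := by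
  have : (fun ω : ℝ × (ℕ → ℝ) => ω.2 k) = (fun ε : ℕ → ℝ => ε k) ∘ Prod.snd := rfl
  rw [this, ← Measure.map_map (measurable_pi_apply k) measurable_snd, map_snd_armLaw, noise,
    Measure.infinitePi_map_eval]

theorem memLp_fst_armLaw : MemLp (fun ω => ω.1) 2 (armLaw ν v) := by
  have h : MemLp id 2 ((armLaw ν v).map Prod.fst) := by
    rw [map_fst_armLaw]; exact memLp_id_gaussianReal 2
  exact h.comp_of_map measurable_fst.aemeasurable

theorem memLp_noise_armLaw (k : ℕ) : MemLp (fun ω => ω.2 k) 2 (armLaw ν v) := by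
  have h : MemLp id 2 ((armLaw ν v).map (fun ω => ω.2 k)) := by
    rw [map_noise_armLaw]; exact memLp_id_gaussianReal 2
  exact h.comp_of_map ((measurable_pi_apply k).comp measurable_snd).aemeasurable

theorem integrable_fst_armLaw : Integrable (fun ω => ω.1) (armLaw ν v) :=
  (memLp_fst_armLaw ν v).integrable one_le_two

theorem integrable_noise_armLaw (k : ℕ) : Integrable (fun ω => ω.2 k) (armLaw ν v) :=
  (memLp_noise_armLaw ν v k).integrable one_le_two

theorem integral_fst_armLaw : ∫ ω, ω.1 ∂(armLaw ν v) = ν := by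
  have := integral_map (μ := armLaw ν v) measurable_fst.aemeasurable
    (f := fun x : ℝ => x) aestronglyMeasurable_id
  rw [← this, map_fst_armLaw, integral_id_gaussianReal]

theorem integral_noise_armLaw (k : ℕ) : ∫ ω, ω.2 k ∂(armLaw ν v) = 0 := by
  have := integral_map (μ := armLaw ν v)
    ((measurable_pi_apply k).comp measurable_snd).aemeasurable
    (f := fun x : ℝ => x) aestronglyMeasurable_id
  simp only [Function.comp_apply] at this
  rw [← this]
  change ∫ x, x ∂((armLaw ν v).map fun ω => ω.2 k) = 0
  rw [map_noise_armLaw, integral_id_gaussianReal]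

theorem indepFun_fst_snd_armLaw :
    IndepFun (fun ω => ω.1) (fun ω => ω.2) (armLaw ν v) :=
  indepFun_prod (X := id) (Y := id) measurable_id measurable_id

theorem iIndepFun_noise_armLaw : iIndepFun (fun k ω => ω.2 k) (armLaw ν v) := by
  have hm : ∀ k, Measurable fun ω : ℝ × (ℕ → ℝ) => ω.2 k := fun k =>
    (measurable_pi_apply k).comp measurable_snd
  rw [iIndepFun_iff_map_fun_eq_infinitePi_map hm]
  simp_rw [map_noise_armLaw]
  exact map_snd_armLaw ν v

theorem covariance_fst_fst_armLaw :
    cov[fun ω => ω.1, fun ω => ω.1; armLaw ν v] = v := by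
  rw [covariance_self measurable_fst.aemeasurable]
  have := variance_id_map (μ := armLaw ν v) (X := Prod.fst) measurable_fst.aemeasurable
  rw [map_fst_armLaw, variance_id_gaussianReal] at this
  exact this.symm

theorem covariance_noise_self_armLaw (k : ℕ) :
    cov[fun ω => ω.2 k, fun ω => ω.2 k; armLaw ν v] = 1 := by
  have hm : AEMeasurable (fun ω : ℝ × (ℕ → ℝ) => ω.2 k) (armLaw ν v) :=
    ((measurable_pi_apply k).comp measurable_snd).aemeasurable
  rw [covariance_self hm]
  have := variance_id_map hm
  rw [map_noise_armLaw, variance_id_gaussianReal] at this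
  simpa using this.symm

theorem covariance_fst_noise_armLaw (k : ℕ) :
    cov[fun ω => ω.1, fun ω => ω.2 k; armLaw ν v] = 0 :=
  ((indepFun_fst_snd_armLaw ν v).comp measurable_id (measurable_pi_apply k)).covariance_eq_zero
    (memLp_fst_armLaw ν v) (memLp_noise_armLaw ν v k)

theorem covariance_noise_noise_armLaw {j k : ℕ} (h : j ≠ k) :
    cov[fun ω => ω.2 j, fun ω => ω.2 k; armLaw ν v] = 0 :=
  ((iIndepFun_noise_armLaw ν v).indepFun h).covariance_eq_zero
    (memLp_noise_armLaw ν v j) (memLp_noise_armLaw ν v k)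

theorem hasGaussianLaw_armLaw (k : ℕ) :
    HasGaussianLaw (fun ω => (ω.1, fun s : Fin k => ω.2 s)) (armLaw ν v) := by
  refine IndepFun.hasGaussianLaw ⟨?_⟩ (iIndepFun.hasGaussianLaw (fun s => ⟨?_⟩) ?_) ?_
  · have := map_fst_armLaw ν v
    change IsGaussian ((armLaw ν v).map Prod.fst)
    rw [this]; infer_instance
  · change IsGaussian ((armLaw ν v).map fun ω => ω.2 s)
    rw [map_noise_armLaw]; infer_instance
  · exact (iIndepFun_noise_armLaw ν v).precomp Fin.val_injective
  · exact (indepFun_fst_snd_armLaw ν v).comp measurable_id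
      (measurable_pi_lambda _ fun s : Fin k => measurable_pi_apply (s : ℕ))

/-- The residual of the regression of the mean on the noise is independent of the observations. -/
theorem indepFun_residual_obs (k : ℕ) :
    IndepFun (fun ω => ω.1 - (v : ℝ) * ∑ s : Fin k, ω.2 s) (obs k) (armLaw ν v) := by
  -- The residual and the observations are jointly Gaussian as a linear image of a Gaussian vector,
  -- so vanishing covariances `v - v * 1 = 0` suffice. The residual is put in `Fin 1 → ℝ` to fit the
  -- vector-valued independence criterion.
  let L : ℝ × (Fin k → ℝ) →L[ℝ] (Fin 1 → ℝ) × (Fin k → ℝ) :=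
    LinearMap.toContinuousLinearMap
      { toFun := fun p => (fun _ => p.1 - v * ∑ s, p.2 s, fun s => p.1 + p.2 s)
        map_add' := fun p q => by
          ext s
          · simp [Finset.sum_add_distrib]; ring
          · simp; ring
        map_smul' := fun c p => by
          ext s
          · simp [← Finset.mul_sum]; ring
          · simp; ring }
  have hL := (hasGaussianLaw_armLaw ν v k).map_fun L
  have key : IndepFun (fun ω (_ : Fin 1) => ω.1 - (v : ℝ) * ∑ s : Fin k, ω.2 s)
      (fun ω (s : Fin k) => ω.1 + ω.2 s) (armLaw ν v) := by
    refine HasGaussianLaw.indepFun_of_covariance_eval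
      (X := fun (_ : Fin 1) (ω : ℝ × (ℕ → ℝ)) => ω.1 - (v : ℝ) * ∑ s : Fin k, ω.2 s)
      (Y := fun (s : Fin k) (ω : ℝ × (ℕ → ℝ)) => ω.1 + ω.2 s) hL fun _ j => ?_
    have hf := memLp_fst_armLaw ν v
    have hn := memLp_noise_armLaw ν v
    have hs : MemLp (fun ω : ℝ × (ℕ → ℝ) => ∑ s : Fin k, ω.2 s) 2 (armLaw ν v) :=
      memLp_finsetSum _ fun s _ => hn s
    have hfn : MemLp (fun ω : ℝ × (ℕ → ℝ) => ω.1 + ω.2 j) 2 (armLaw ν v) := hf.add (hn j)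
    rw [covariance_fun_sub_left hf (hs.const_mul _) hfn,
      covariance_const_mul_left]
    have e1 : cov[fun ω => ω.1, fun ω => ω.1 + ω.2 j; armLaw ν v] = v := by
      have := covariance_add_right hf hf (hn j)
      rw [covariance_fst_fst_armLaw, covariance_fst_noise_armLaw, add_zero] at this
      exact this
    have e2 : cov[fun ω => ∑ s : Fin k, ω.2 s, fun ω => ω.1 + ω.2 j; armLaw ν v] = 1 := by
      rw [covariance_fun_sum_left (fun s : Fin k => hn s) hfn, Finset.sum_eq_single j]
      · have := covariance_add_right (hn j) hf (hn j)
        rw [covariance_comm _ (fun ω : ℝ × (ℕ → ℝ) => ω.1), covariance_fst_noise_armLaw, covariance_noise_self_armLaw,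
          zero_add] at this
        exact this
      · intro s _ hsj
        have := covariance_add_right (hn s) hf (hn j)
        rw [covariance_comm _ (fun ω : ℝ × (ℕ → ℝ) => ω.1), covariance_fst_noise_armLaw,
          covariance_noise_noise_armLaw ν v (fun h => hsj (Fin.ext h)), zero_add] at this
        exact this
      · simp
    rw [e1, e2]; ring
  exact key.comp (measurable_pi_apply 0) measurable_id

/-- The centred residual is independent of the observations, so it integrates to 0 over any event
that they determine. -/
theorem setIntegral_fst_sub_eq {k : ℕ} {B : Set (Fin k → ℝ)} (hB : MeasurableSet B) :
    ∫ ω in obs k ⁻¹' B, (ω.1 - ν) ∂(armLaw ν v) =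
      v * ∫ ω in obs k ⁻¹' B, (∑ s : Fin k, ω.2 s) ∂(armLaw ν v) := by
  have hA : MeasurableSet (obs k ⁻¹' B) := measurable_obs k hB
  have hi1 := integrable_fst_armLaw ν v
  have hi2 : Integrable (fun ω : ℝ × (ℕ → ℝ) => ∑ s : Fin k, ω.2 s) (armLaw ν v) :=
    integrable_finsetSum _ fun s _ => integrable_noise_armLaw ν v s
  have hi3 : Integrable (fun ω : ℝ × (ℕ → ℝ) => ω.1 - v * ∑ s : Fin k, ω.2 s) (armLaw ν v) :=
    hi1.sub (hi2.const_mul _)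
  have hi4 : Integrable (fun ω => ω.1 - ν) (armLaw ν v) := hi1.sub (integrable_const _)
  have hind := (indepFun_residual_obs ν v k).integral_fun_comp_mul_comp
    (f := fun x => x - ν) (g := B.indicator 1)
    (by
      refine Measurable.aemeasurable (measurable_fst.sub (measurable_const.mul
        (Finset.measurable_sum _ fun s _ => ?_)))
      exact (measurable_pi_apply _).comp measurable_snd)
    (measurable_obs k).aemeasurable (by fun_prop)
    ((measurable_const (a := (1 : ℝ))).indicator hB).aestronglyMeasurable
  have h0 : ∫ ω, ((ω.1 - v * ∑ s : Fin k, ω.2 s) - ν) ∂(armLaw ν v) = 0 := by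
    rw [integral_sub hi3 (integrable_const _),
      integral_sub hi1 (hi2.const_mul _), integral_const_mul, integral_fst_armLaw,
      integral_finsetSum _ fun s _ => integrable_noise_armLaw ν v (Fin.val s)]
    simp [integral_noise_armLaw]
  rw [h0, zero_mul] at hind
  have e : ∀ ω, ((ω.1 - v * ∑ s : Fin k, ω.2 s) - ν) * B.indicator 1 (obs k ω) =
      (obs k ⁻¹' B).indicator (fun ω => (ω.1 - ν) - v * ∑ s : Fin k, ω.2 s) ω := by
    intro ω
    by_cases h : obs k ω ∈ B
    · simp [h]; ring
    · simp [h]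
  simp_rw [e] at hind
  rw [integral_indicator hA, integral_sub hi4.integrableOn
    (hi2.const_mul _).integrableOn, integral_const_mul] at hind
  linarith

end Arm

theorem sq_setIntegral_le {Ω : Type*} [MeasurableSpace Ω] {P : Measure Ω}
    [IsProbabilityMeasure P] {f : Ω → ℝ} (hf : MemLp f 2 P) {A : Set Ω} (hA : MeasurableSet A) :
    (∫ ω in A, f ω ∂P) ^ 2 ≤ (∫ ω, f ω ^ 2 ∂P) * P.real A := by
  have hi := hf.integrable one_le_two
  have hsq := hf.integrable_sq
  -- Cauchy–Schwarz through the discriminant: the quadratic is `∫ (f - t)²` over `A` plus `∫ f²`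
  -- over the complement.
  have h : ∀ t : ℝ, 0 ≤ P.real A * (t * t) + (-2 * ∫ ω in A, f ω ∂P) * t + ∫ ω, f ω ^ 2 ∂P := by
    intro t
    have h1 : 0 ≤ ∫ ω, (f ω ^ 2 + (A.indicator (fun _ => t * t) ω -
        2 * t * A.indicator f ω)) ∂P := by
      refine integral_nonneg fun ω => ?_
      by_cases hω : ω ∈ A
      · simp only [hω, Set.indicator_of_mem]
        show 0 ≤ f ω ^ 2 + (t * t - 2 * t * f ω)
        nlinarith [sq_nonneg (f ω - t)]
      · simp [hω]; positivity
    have i1 : Integrable (fun ω => A.indicator (fun _ => t * t) ω) P :=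
      (integrable_const _).indicator hA
    have i2 : Integrable (fun ω => 2 * t * A.indicator f ω) P := (hi.indicator hA).const_mul _
    have i3 : Integrable (fun ω => A.indicator (fun _ => t * t) ω - 2 * t * A.indicator f ω) P :=
      i1.sub i2
    rw [integral_add hsq i3, integral_sub i1 i2, integral_const_mul,
      integral_indicator hA, integral_indicator hA, setIntegral_const, smul_eq_mul] at h1
    linarith
  have := discrim_le_zero h
  unfold discrim at this
  nlinarith

/-- Two Cauchy–Schwarz bounds are added: the variance `v` of the mean bounds the square by `v P(A)`,
and the expression through the noise, of variance `k`, bounds it by `v² k P(A)`. The first is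
multiplied by `v`. The factor `1 + v` keeps the estimate sharp enough for both small and large `v`.
-/
theorem sq_setIntegral_fst_sub_le (ν : ℝ) (v : ℝ≥0) {k : ℕ} {B : Set (Fin k → ℝ)}
    (hB : MeasurableSet B) :
    (1 + v) * (∫ ω in obs k ⁻¹' B, (ω.1 - ν) ∂(armLaw ν v)) ^ 2 ≤
      (v : ℝ) ^ 2 * (k + 1) * (armLaw ν v).real (obs k ⁻¹' B) := by
  have hA : MeasurableSet (obs k ⁻¹' B) := measurable_obs k hB
  have hf := memLp_fst_armLaw ν v
  have hn := memLp_noise_armLaw ν v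
  have hs : MemLp (fun ω : ℝ × (ℕ → ℝ) => ∑ s : Fin k, ω.2 s) 2 (armLaw ν v) :=
    memLp_finsetSum _ fun s _ => hn s
  have h1 := sq_setIntegral_le (hf.sub (memLp_const ν)) hA
  have h2 := sq_setIntegral_le hs hA
  have e1 : ∫ ω, (ω.1 - ν) ^ 2 ∂(armLaw ν v) = v := by
    have := covariance_fst_fst_armLaw ν v
    rw [covariance_self measurable_fst.aemeasurable,
      variance_eq_integral measurable_fst.aemeasurable, integral_fst_armLaw] at this
    exact this
  have e2 : ∫ ω, (∑ s : Fin k, ω.2 s) ^ 2 ∂(armLaw ν v) = k := by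
    have h0 : ∫ ω, (∑ s : Fin k, ω.2 s) ∂(armLaw ν v) = 0 := by
      rw [integral_finsetSum _ fun s _ => integrable_noise_armLaw ν v (Fin.val s)]
      simp [integral_noise_armLaw]
    have hv : cov[fun ω => ∑ s : Fin k, ω.2 s, fun ω => ∑ s : Fin k, ω.2 s; armLaw ν v] = k := by
      rw [covariance_fun_sum_fun_sum (fun s : Fin k => hn s) (fun s : Fin k => hn s)]
      have : ∀ s : Fin k, ∑ j : Fin k, cov[fun ω => ω.2 s, fun ω => ω.2 j; armLaw ν v] = 1 := by
        intro s
        rw [Finset.sum_eq_single s]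
        · exact covariance_noise_self_armLaw ν v s
        · intro j _ hj
          exact covariance_noise_noise_armLaw ν v (fun h => hj (Fin.ext h.symm))
        · simp
      simp [this]
    rw [covariance_self hs.aestronglyMeasurable.aemeasurable,
      variance_eq_integral hs.aestronglyMeasurable.aemeasurable, h0] at hv
    simpa using hv
  simp only [Pi.sub_apply] at h1
  rw [e1] at h1
  rw [e2] at h2
  have h3 := setIntegral_fst_sub_eq ν v hB
  have hP : 0 ≤ (armLaw ν v).real (obs k ⁻¹' B) := measureReal_nonneg
  have hv : (0 : ℝ) ≤ v := v.2
  set x := ∫ ω in obs k ⁻¹' B, (ω.1 - ν) ∂(armLaw ν v)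
  have h4 : x ^ 2 ≤ (v : ℝ) ^ 2 * (k * (armLaw ν v).real (obs k ⁻¹' B)) := by
    rw [h3, mul_pow]
    exact mul_le_mul_of_nonneg_left h2 (by positivity)
  nlinarith [mul_le_mul_of_nonneg_left h1 hv]

/-- The mean of the positive part of a standard Gaussian variable. -/
def gaussianPosPart : ℝ := ∫ x, max x 0 ∂(gaussianReal 0 1)

theorem gaussianPosPart_pos : 0 < gaussianPosPart := by
  have hi : Integrable (fun x : ℝ => max x 0) (gaussianReal 0 1) :=
    ((memLp_id_gaussianReal 1).integrable le_rfl).pos_part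
  refine (integral_pos_iff_support_of_nonneg (fun x => le_max_right _ _) hi).2 ?_
  have : Function.support (fun x : ℝ => max x 0) = Set.Ioi 0 := by
    ext x; simp
  change 0 < gaussianReal 0 1 (Function.support fun x : ℝ => max x 0)
  rw [this]
  refine pos_iff_ne_zero.2 fun h => ?_
  have := gaussianReal_absolutelyContinuous' 0 one_ne_zero h
  simp at this

/-- The first observation has law `N(ν, 1 + v)`, so its centred positive part has mean `√(1 + v) *
gaussianPosPart`. By `setIntegral_fst_sub_eq` the unknown mean contributes the fraction `v / (1 +
v)` of it. -/
theorem setIntegral_first_obs_nonneg (ν : ℝ) (v : ℝ≥0) :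
    (1 + v) * ∫ ω in obs 1 ⁻¹' {z | ν ≤ z 0}, (ω.1 - ν) ∂(armLaw ν v) =
      v * (√(1 + v) * gaussianPosPart) := by
  have hB : MeasurableSet {z : Fin 1 → ℝ | ν ≤ z 0} :=
    measurableSet_le measurable_const (measurable_pi_apply 0)
  have hA : MeasurableSet (obs 1 ⁻¹' {z | ν ≤ z 0}) := measurable_obs 1 hB
  have hi1 : Integrable (fun ω => ω.1 - ν) (armLaw ν v) :=
    (integrable_fst_armLaw ν v).sub (integrable_const ν)
  have hi2 := integrable_noise_armLaw ν v 0
  have h1 := setIntegral_fst_sub_eq ν v hB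
  simp only [Fin.sum_univ_one, Fin.val_zero] at h1
  have h2 : (∫ ω in obs 1 ⁻¹' {z | ν ≤ z 0}, (ω.1 - ν) ∂(armLaw ν v)) +
      ∫ ω in obs 1 ⁻¹' {z | ν ≤ z 0}, ω.2 0 ∂(armLaw ν v) = √(1 + v) * gaussianPosPart := by
    rw [← integral_add hi1.integrableOn hi2.integrableOn, ← integral_indicator hA]
    have e : (obs 1 ⁻¹' {z | ν ≤ z 0}).indicator (fun ω => ω.1 - ν + ω.2 0) =
        fun ω => max ((ω.1 + ω.2 0) - ν) 0 := by
      ext ω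
      by_cases h : ν ≤ ω.1 + ω.2 0
      · rw [Set.indicator_of_mem (by simpa [obs] using h), max_eq_left (by linarith)]; ring
      · rw [Set.indicator_of_notMem (by simpa [obs] using h), max_eq_right (by linarith)]
    have hm : Measurable fun ω : ℝ × (ℕ → ℝ) => ω.1 + ω.2 0 :=
      measurable_fst.add ((measurable_pi_apply 0).comp measurable_snd)
    have hlaw : (armLaw ν v).map (fun ω => ω.1 + ω.2 0) = gaussianReal (ν + 0) (v + 1) :=
      gaussianReal_add_gaussianReal_of_indepFun
        ((indepFun_fst_snd_armLaw ν v).comp measurable_id (measurable_pi_apply 0))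
        (map_fst_armLaw ν v) (map_noise_armLaw ν v 0)
    have hscale : gaussianReal (ν + 0) (v + 1) =
        (gaussianReal 0 1).map (fun x => √(1 + v) * x + ν) := by
      have hc : (fun x : ℝ => √(1 + (v : ℝ)) * x + ν) = (· + ν) ∘ (√(1 + (v : ℝ)) * ·) := rfl
      rw [hc, ← Measure.map_map (by fun_prop) (by fun_prop), gaussianReal_map_const_mul,
        gaussianReal_map_add_const]
      congr 1
      · simp
      · ext
        simpa [add_comm] using (Real.sq_sqrt (show (0 : ℝ) ≤ 1 + v by positivity)).symm
    calc ∫ ω, (obs 1 ⁻¹' {z | ν ≤ z 0}).indicator (fun ω => ω.1 - ν + ω.2 0) ω ∂(armLaw ν v)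
        = ∫ y, max (y - ν) 0 ∂((armLaw ν v).map (fun ω => ω.1 + ω.2 0)) := by
          rw [e, integral_map hm.aemeasurable (by fun_prop)]
      _ = ∫ x, max (√(1 + v) * x + ν - ν) 0 ∂(gaussianReal 0 1) := by
          rw [hlaw, hscale, integral_map (by fun_prop) (by fun_prop)]
      _ = √(1 + v) * gaussianPosPart := by
          rw [gaussianPosPart, ← integral_const_mul]
          congr 1
          ext x
          rw [add_sub_cancel_right, mul_max_of_nonneg _ _ (Real.sqrt_nonneg _), mul_zero]
  rw [← h2, mul_add, h1]; ring

/-! ### Stopping rules as functions of the observations -/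

/-- The sequence of observations of an arm with mean `ω.1` and noise `ω.2`. -/
def rewards (ω : ℝ × (ℕ → ℝ)) : ℕ → ℝ := fun k => ω.1 + ω.2 k

theorem measurable_rewards : Measurable rewards := by
  unfold rewards; fun_prop

/-- A stopping time `1 ≤ T ≤ m`, as a function of the sequence of observations. -/
structure IsRule (m : ℕ) (T : (ℕ → ℝ) → ℕ) : Prop where
  measurable : Measurable T
  nonAnticipating : Strategy.NonAnticipating T
  one_le : ∀ y, 1 ≤ T y
  le : ∀ y, T y ≤ m

theorem IsRule.isStoppingRule {m : ℕ} {T : (ℕ → ℝ) → ℕ} (h : IsRule m T) :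
    IsStoppingRule m fun ω => T (rewards ω) :=
  isStoppingRule_of_nonAnticipating h.measurable h.nonAnticipating h.one_le h.le

theorem IsStoppingRule.isRule {m : ℕ} {τ : ℝ × (ℕ → ℝ) → ℕ} (h : IsStoppingRule m τ) :
    IsRule m fun y => τ (0, y) where
  measurable := h.measurable.comp measurable_prodMk_left
  nonAnticipating := h.nonAnticipating
  one_le _ := h.one_le _
  le _ := h.le _

theorem isRule_const {m n : ℕ} (hm : 1 ≤ m) (hmn : m ≤ n) : IsRule n fun _ => m where
  measurable := measurable_const
  nonAnticipating _ _ _ := rfl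
  one_le _ := hm
  le _ := hmn

/-- The event that a rule uses the whole horizon `n` is determined by the first `k` observations
if `n ≤ k + 1`. -/
theorem IsRule.exists_preimage_obs {n k : ℕ} {T : (ℕ → ℝ) → ℕ} (h : IsRule n T)
    (hk : n ≤ k + 1) :
    ∃ B : Set (Fin k → ℝ), MeasurableSet B ∧ obs k ⁻¹' B = {ω | T (rewards ω) = n} := by
  -- The event `T = n` is the complement of `T ≤ n - 1`, which is why `n - 1` observations decide
  -- it.
  let pad : (Fin k → ℝ) → ℕ → ℝ := fun z i => if hi : i < k then z ⟨i, hi⟩ else 0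
  have hpad : Measurable pad := measurable_pi_lambda _ fun i => by
    by_cases hi : i < k
    · simpa [pad, hi] using measurable_pi_apply _
    · simp [pad, hi]
  refine ⟨{z | T (pad z) = n}, (h.measurable.comp hpad) (measurableSet_singleton n), ?_⟩
  ext ω
  have hk' : ∀ i < k, pad (obs k ω) i = rewards ω i := fun i hi => by
    simp [pad, hi, obs, rewards]
  have h1 := h.le (pad (obs k ω))
  have h2 := h.le (rewards ω)
  simp only [Set.mem_preimage, Set.mem_ofPred_eq]
  constructor
  · intro he
    by_contra hne
    have := h.nonAnticipating (rewards ω) (pad (obs k ω))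
      fun i hi => (hk' i (by omega)).symm
    omega
  · intro he
    by_contra hne
    have := h.nonAnticipating (pad (obs k ω)) (rewards ω) fun i hi => hk' i (by omega)
    omega

/-! ### Nearly optimal stopping rules at the Gittins index -/

section Value

variable {ν : ℝ} {v : ℝ≥0} {n : ℕ}

theorem integrable_sub_mul (γ : ℝ) {f : ℝ × (ℕ → ℝ) → ℝ} (hf : Measurable f) {M : ℝ}
    (hM : ∀ ω, |f ω| ≤ M) : Integrable (fun ω => (ω.1 - γ) * f ω) (armLaw ν v) := by
  have : Integrable (fun ω => ω.1 - γ) (armLaw ν v) :=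
    (integrable_fst_armLaw ν v).sub (integrable_const γ)
  exact this.mul_bdd hf.aestronglyMeasurable (Filter.Eventually.of_forall hM)

theorem IsRule.measurable_cast {T : (ℕ → ℝ) → ℕ} (h : IsRule n T) :
    Measurable fun ω => (T (rewards ω) : ℝ) :=
  measurable_from_top.comp (h.measurable.comp measurable_rewards)

theorem IsRule.abs_le {T : (ℕ → ℝ) → ℕ} (h : IsRule n T) (ω : ℝ × (ℕ → ℝ)) :
    |(T (rewards ω) : ℝ)| ≤ n := by
  rw [abs_of_nonneg (Nat.cast_nonneg _)]
  exact_mod_cast h.le _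

theorem IsRule.integral_le_stoppingValue {T : (ℕ → ℝ) → ℕ} (h : IsRule n T) (γ : ℝ) :
    ∫ ω, (ω.1 - γ) * (T (rewards ω) : ℝ) ∂(armLaw ν v) ≤ stoppingValue ν v n γ := by
  have hbdd : BddAbove (Set.range fun τ : {τ // IsStoppingRule n τ} =>
      ∫ ω, (ω.1 - γ) * (τ.1 ω : ℝ) ∂(armLaw ν v)) := by
    refine ⟨∫ ω, |ω.1 - γ| * n ∂(armLaw ν v), ?_⟩
    rintro _ ⟨τ, rfl⟩
    have hb : ∀ ω, |(τ.1 ω : ℝ)| ≤ n := fun ω => by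
      rw [abs_of_nonneg (Nat.cast_nonneg _)]
      exact_mod_cast τ.2.le ω
    have hi : Integrable (fun ω => |ω.1 - γ|) (armLaw ν v) :=
      ((integrable_fst_armLaw ν v).sub (integrable_const γ)).abs
    refine integral_mono (integrable_sub_mul γ (measurable_from_top.comp τ.2.measurable) hb)
      (hi.mul_const _) fun ω => ?_
    refine (le_abs_self _).trans ?_
    rw [abs_mul]
    exact mul_le_mul_of_nonneg_left (hb ω) (abs_nonneg _)
  exact le_ciSup hbdd ⟨_, h.isStoppingRule⟩

/-- At the Gittins index, no rule has a positive value. -/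
theorem IsRule.integral_nonpos {T : (ℕ → ℝ) → ℕ} (h : IsRule n T) (hn : 1 ≤ n) :
    ∫ ω, (ω.1 - gittinsIndex ν v n) * (T (rewards ω) : ℝ) ∂(armLaw ν v) ≤ 0 := by
  set G := gittinsIndex ν v n
  refine le_of_forall_pos_le_add fun e he => ?_
  have hn0 : (0 : ℝ) < n := by exact_mod_cast hn
  -- Any level above `G` has negative value; lowering the level back by `e / n` costs at most `e`,
  -- since `T ≤ n`.
  have h1 : stoppingValue ν v n (G + e / n) < 0 := by
    by_contra hcon
    have := (isGreatest_gittinsIndex ν v hn).2 (not_lt.1 hcon)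
    have : 0 < e / n := by positivity
    linarith
  have h2 := h.integral_le_stoppingValue (ν := ν) (v := v) (G + e / n)
  have hiT : Integrable (fun ω => (T (rewards ω) : ℝ)) (armLaw ν v) :=
    Integrable.of_bound h.measurable_cast.aestronglyMeasurable n
      (Filter.Eventually.of_forall h.abs_le)
  have h3 : ∫ ω, (ω.1 - (G + e / n)) * (T (rewards ω) : ℝ) ∂(armLaw ν v) =
      (∫ ω, (ω.1 - G) * (T (rewards ω) : ℝ) ∂(armLaw ν v)) -
        e / n * ∫ ω, (T (rewards ω) : ℝ) ∂(armLaw ν v) := by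
    rw [← integral_const_mul, ← integral_sub (integrable_sub_mul G h.measurable_cast h.abs_le)
      (hiT.const_mul _)]
    congr 1; ext ω; ring
  have h4 : ∫ ω, (T (rewards ω) : ℝ) ∂(armLaw ν v) ≤ n := by
    have := integral_mono hiT (integrable_const (n : ℝ))
      fun ω => (le_abs_self _).trans (h.abs_le ω)
    simpa using this
  have h5 : e / n * ∫ ω, (T (rewards ω) : ℝ) ∂(armLaw ν v) ≤ e := by
    calc _ ≤ e / n * n := mul_le_mul_of_nonneg_left h4 (by positivity)
      _ = e := by field_simp
  linarith

theorem exists_isRule_lt_integral (ν : ℝ) (v : ℝ≥0) (hn : 1 ≤ n) {ε : ℝ} (hε : 0 < ε) :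
    ∃ T, IsRule n T ∧
      -ε < ∫ ω, (ω.1 - gittinsIndex ν v n) * (T (rewards ω) : ℝ) ∂(armLaw ν v) := by
  have : Nonempty {τ // IsStoppingRule n τ} := ⟨⟨_, isStoppingRule_one hn⟩⟩
  obtain ⟨τ, hτ⟩ := exists_lt_of_lt_ciSup
    (lt_of_lt_of_le (neg_lt_zero.2 hε) (isGreatest_gittinsIndex ν v hn).1)
  refine ⟨_, τ.2.isRule, ?_⟩
  have : ∀ ω, τ.1 (0, rewards ω) = τ.1 ω := fun ω => τ.2.apply_eq ω
  simpa only [this] using hτ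

/-- Extending a rule by one observation when it stops at time `t`. -/
theorem IsRule.extend {T : (ℕ → ℝ) → ℕ} (h : IsRule n T) {t : ℕ} (ht : t < n) :
    IsRule n fun y => if T y = t then t + 1 else T y where
  measurable := Measurable.ite (h.measurable (measurableSet_singleton t)) measurable_const
    h.measurable
  nonAnticipating y y' hy := by
    have : T y' = T y := h.nonAnticipating y y' fun k hk => hy k (by
      simp only; split_ifs <;> omega)
    simp only [this]
  one_le y := by have := h.one_le y; split_ifs <;> omega
  le y := by have := h.le y; split_ifs <;> omega

theorem IsRule.measurableSet_eq {T : (ℕ → ℝ) → ℕ} (h : IsRule n T) (t : ℕ) :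
    MeasurableSet {ω | T (rewards ω) = t} :=
  (h.measurable.comp measurable_rewards) (measurableSet_singleton t)

/-- A nearly optimal rule nearly gains from its last observation on average as much as from the
other ones. -/
theorem IsRule.le_mul_setIntegral {T : (ℕ → ℝ) → ℕ} (h : IsRule n T) (hn : 1 ≤ n) {ε : ℝ}
    (hε : 0 ≤ ε)
    (hT : -ε < ∫ ω, (ω.1 - gittinsIndex ν v n) * (T (rewards ω) : ℝ) ∂(armLaw ν v)) :
    (gittinsIndex ν v n - ν) - (n ^ 2 + 1) * ε ≤
      (n - 1) * ∫ ω in {ω | T (rewards ω) = n}, (ω.1 - gittinsIndex ν v n) ∂(armLaw ν v) := by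
  set G := gittinsIndex ν v n
  let b : ℕ → ℝ := fun t => ∫ ω in {ω | T (rewards ω) = t}, (ω.1 - G) ∂(armLaw ν v)
  have hi : Integrable (fun ω => ω.1 - G) (armLaw ν v) :=
    (integrable_fst_armLaw ν v).sub (integrable_const G)
  have hind : ∀ t, Integrable ({ω | T (rewards ω) = t}.indicator fun ω => ω.1 - G) (armLaw ν v) :=
    fun t => hi.indicator (h.measurableSet_eq t)
  -- Observing once more on `{T = t}` adds `b t` to the value, which stays nonpositive while it
  -- already exceeds `-ε`.
  have hb : ∀ t < n, b t ≤ ε := by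
    intro t ht
    have h1 := (h.extend ht).integral_nonpos (ν := ν) (v := v) hn
    have h2 : ∫ ω, (ω.1 - G) *
        ((if T (rewards ω) = t then t + 1 else T (rewards ω) : ℕ) : ℝ) ∂(armLaw ν v) =
        (∫ ω, (ω.1 - G) * (T (rewards ω) : ℝ) ∂(armLaw ν v)) + b t := by
      simp only [b]
      rw [← integral_indicator (h.measurableSet_eq t),
        ← integral_add (integrable_sub_mul G h.measurable_cast h.abs_le) (hind t)]
      congr 1
      ext ω
      by_cases hω : T (rewards ω) = t
      · simp [hω]; ring
      · simp [hω]
    linarith [h2 ▸ h1]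
  -- Write `T = 1 + (T - 1)`: the compulsory first pull contributes `ν - G`, and the remaining ones
  -- are sorted by the value of `T`.
  have hsum : ∫ ω, (ω.1 - G) * (T (rewards ω) : ℝ) ∂(armLaw ν v) =
      (ν - G) + (∑ t ∈ Finset.Ico 1 n, ((t : ℝ) - 1) * b t) + (n - 1) * b n := by
    have e : ∀ ω, (ω.1 - G) * (T (rewards ω) : ℝ) =
        (ω.1 - G) + ∑ t ∈ Finset.Ico 1 (n + 1), ((t : ℝ) - 1) *
          {ω | T (rewards ω) = t}.indicator (fun ω => ω.1 - G) ω := by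
      intro ω
      have h1 := h.one_le (rewards ω)
      have h2 := h.le (rewards ω)
      rw [Finset.sum_eq_single_of_mem (T (rewards ω)) (Finset.mem_Ico.2 ⟨h1, by omega⟩)]
      · simp; ring
      · intro t _ ht
        simp [ht.symm]
    simp_rw [e]
    rw [integral_add hi (integrable_finsetSum _ fun t _ => (hind t).const_mul _),
      integral_finsetSum _ fun t _ => (hind t).const_mul _,
      integral_sub (integrable_fst_armLaw ν v) (integrable_const _), integral_fst_armLaw,
      Finset.sum_Ico_succ_top hn]
    simp_rw [integral_const_mul, integral_indicator (h.measurableSet_eq _)]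
    simp [b]; ring
  have hle : ∑ t ∈ Finset.Ico 1 n, ((t : ℝ) - 1) * b t ≤ n ^ 2 * ε := by
    calc _ ≤ ∑ t ∈ Finset.Ico 1 n, (n : ℝ) * ε := by
          refine Finset.sum_le_sum fun t ht => ?_
          obtain ⟨h1, h2⟩ := Finset.mem_Ico.1 ht
          have h1' : (1 : ℝ) ≤ t := by exact_mod_cast h1
          have h2' : (t : ℝ) ≤ n := by exact_mod_cast h2.le
          calc ((t : ℝ) - 1) * b t ≤ ((t : ℝ) - 1) * ε :=
                mul_le_mul_of_nonneg_left (hb t h2) (by linarith)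
            _ ≤ n * ε := mul_le_mul_of_nonneg_right (by linarith) hε
      _ ≤ n ^ 2 * ε := by
          rw [Finset.sum_const, Nat.card_Ico, nsmul_eq_mul]
          have : ((n - 1 : ℕ) : ℝ) ≤ n := by exact_mod_cast Nat.sub_le n 1
          have : ((n - 1 : ℕ) : ℝ) * (n * ε) ≤ n * (n * ε) :=
            mul_le_mul_of_nonneg_right this (by positivity)
          nlinarith
  change _ ≤ ((n : ℝ) - 1) * b n
  linarith

/-- The Gittins index exceeds the prior mean by a multiple of the posterior deviation. -/
theorem le_mul_gittinsIndex_sub (ν : ℝ) (v : ℝ≥0) (hn : 2 ≤ n) :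
    (n - 1) * (v * (√(1 + v) * gaussianPosPart)) ≤
      (1 + v) * (n * (gittinsIndex ν v n - ν)) := by
  set G := gittinsIndex ν v n
  have hG : ν ≤ G := by
    have := (isRule_const le_rfl (by omega : 1 ≤ n)).integral_nonpos (ν := ν) (v := v) (by omega)
    have h2 : ∫ ω, (ω.1 - G) * ((1 : ℕ) : ℝ) ∂(armLaw ν v) = ν - G := by
      simp only [Nat.cast_one, mul_one]
      rw [integral_sub (integrable_fst_armLaw ν v) (integrable_const _), integral_fst_armLaw]
      simp
    linarith [h2 ▸ this]
  -- The test rule observes once and continues to the horizon exactly when this observation is at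
  -- least the prior mean.
  let T : (ℕ → ℝ) → ℕ := fun y => if ν ≤ y 0 then n else 1
  have hm : MeasurableSet {y : ℕ → ℝ | ν ≤ y 0} :=
    measurableSet_le measurable_const (measurable_pi_apply 0)
  have hT : IsRule n T :=
    { measurable := Measurable.ite hm measurable_const measurable_const
      nonAnticipating := fun y y' hy => by
        have : y 0 = y' 0 := hy 0 (by simp only [T]; split_ifs <;> omega)
        simp only [T, this]
      one_le := fun y => by simp only [T]; split_ifs <;> omega
      le := fun y => by simp only [T]; split_ifs <;> omega }
  have h1 := hT.integral_nonpos (ν := ν) (v := v) (by omega)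
  have hB : MeasurableSet {z : Fin 1 → ℝ | ν ≤ z 0} :=
    measurableSet_le measurable_const (measurable_pi_apply 0)
  have hA : MeasurableSet (obs 1 ⁻¹' {z | ν ≤ z 0}) := measurable_obs 1 hB
  have hi : Integrable (fun ω => ω.1 - G) (armLaw ν v) :=
    (integrable_fst_armLaw ν v).sub (integrable_const G)
  have hi' : Integrable (fun ω => ω.1 - ν) (armLaw ν v) :=
    (integrable_fst_armLaw ν v).sub (integrable_const ν)
  have h2 : ∫ ω, (ω.1 - G) * (T (rewards ω) : ℝ) ∂(armLaw ν v) = (ν - G) +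
      (n - 1) * ∫ ω in obs 1 ⁻¹' {z | ν ≤ z 0}, (ω.1 - G) ∂(armLaw ν v) := by
    have e : ∀ ω, (ω.1 - G) * (T (rewards ω) : ℝ) = (ω.1 - G) + (n - 1) *
        (obs 1 ⁻¹' {z | ν ≤ z 0}).indicator (fun ω => ω.1 - G) ω := by
      intro ω
      by_cases hω : ν ≤ ω.1 + ω.2 0
      · simp [T, rewards, obs, hω]; ring
      · simp [T, rewards, obs, hω]
    simp_rw [e]
    rw [integral_add hi ((hi.indicator hA).const_mul _), integral_const_mul,
      integral_indicator hA, integral_sub (integrable_fst_armLaw ν v) (integrable_const _),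
      integral_fst_armLaw]
    simp
  have h3 : ∫ ω in obs 1 ⁻¹' {z | ν ≤ z 0}, (ω.1 - G) ∂(armLaw ν v) =
      (∫ ω in obs 1 ⁻¹' {z | ν ≤ z 0}, (ω.1 - ν) ∂(armLaw ν v)) -
        (armLaw ν v).real (obs 1 ⁻¹' {z | ν ≤ z 0}) * (G - ν) := by
    have e : ∀ ω : ℝ × (ℕ → ℝ), ω.1 - G = (ω.1 - ν) - (G - ν) := fun ω => by ring
    simp_rw [e]
    rw [integral_sub hi'.integrableOn (integrable_const _), setIntegral_const, smul_eq_mul]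
  have h4 := setIntegral_first_obs_nonneg ν v
  have hp : (armLaw ν v).real (obs 1 ⁻¹' {z | ν ≤ z 0}) ≤ 1 := measureReal_le_one
  have hn1 : (1 : ℝ) ≤ n - 1 := by
    have : (2 : ℝ) ≤ n := by exact_mod_cast hn
    linarith
  have hv : (0 : ℝ) ≤ v := v.2
  set x := ∫ ω in obs 1 ⁻¹' {z | ν ≤ z 0}, (ω.1 - ν) ∂(armLaw ν v)
  set p := (armLaw ν v).real (obs 1 ⁻¹' {z | ν ≤ z 0})
  have h5 : ((n : ℝ) - 1) * x ≤ n * (G - ν) := by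
    have : p * (G - ν) ≤ 1 * (G - ν) := mul_le_mul_of_nonneg_right hp (by linarith)
    have h6 : (ν - G) + (n - 1) * (x - p * (G - ν)) ≤ 0 := by
      rw [← h3, ← h2]; exact h1
    nlinarith
  rw [← h4]
  nlinarith

/-- Nearly optimal rules can be chosen to use the whole horizon with polynomially small
probability. -/
theorem exists_isRule_le_measureReal (ν : ℝ) (v : ℝ≥0) (hn : 1 ≤ n) {ε : ℝ} (hε : 0 < ε) :
    ∃ T, IsRule n T ∧
      -ε < ∫ ω, (ω.1 - gittinsIndex ν v n) * (T (rewards ω) : ℝ) ∂(armLaw ν v) ∧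
      min (gaussianPosPart ^ 2 / 16) 1 / n ^ 3 ≤
        (armLaw ν v).real {ω | T (rewards ω) = n} := by
  have hn0 : (0 : ℝ) < n := by exact_mod_cast hn
  have hn1 : (1 : ℝ) ≤ n := by exact_mod_cast hn
  have hκ := gaussianPosPart_pos
  have hsmall : min (gaussianPosPart ^ 2 / 16) 1 / (n : ℝ) ^ 3 ≤ 1 :=
    div_le_one_of_le₀ ((min_le_right _ _).trans (one_le_pow₀ hn1)) (by positivity)
  rcases Nat.eq_or_lt_of_le hn with rfl | hn2
  · obtain ⟨T, hT, h1⟩ := exists_isRule_lt_integral ν v le_rfl hε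
    refine ⟨T, hT, h1, hsmall.trans_eq ?_⟩
    have : {ω | T (rewards ω) = 1} = Set.univ :=
      Set.eq_univ_of_forall fun ω => le_antisymm (hT.le _) (hT.one_le _)
    rw [this]; simp
  set G := gittinsIndex ν v n
  have hn2' : (2 : ℝ) ≤ n := by exact_mod_cast hn2
  -- Without prior uncertainty the index is `ν` and every rule has value 0, so the constant rule `n`
  -- is available.
  rcases eq_or_ne v 0 with rfl | hv
  · obtain ⟨T, hT, h1⟩ := exists_isRule_lt_integral ν 0 hn hε
    refine ⟨fun _ => n, isRule_const hn le_rfl, ?_, hsmall.trans_eq (by simp)⟩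
    have hconst : ∀ f : ℝ × (ℕ → ℝ) → ℝ, ∫ ω, (ω.1 - G) * f ω ∂(armLaw ν 0) =
        (ν - G) * ∫ ω, f ω ∂(armLaw ν 0) := by
      intro f
      rw [← integral_const_mul]
      refine integral_congr_ae ?_
      have : ∀ᵐ x ∂((armLaw ν 0).map Prod.fst), x = ν := by
        rw [map_fst_armLaw, gaussianReal_zero_var]
        exact (ae_dirac_iff (measurableSet_singleton ν)).2 rfl
      filter_upwards [ae_of_ae_map measurable_fst.aemeasurable this] with ω hω
      rw [hω]
    have hG : ν = G := by
      refine le_antisymm ?_ ?_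
      · have := (isRule_const le_rfl hn).integral_nonpos (ν := ν) (v := 0) hn
        rw [hconst] at this
        simp at this
        linarith
      · refine le_of_forall_pos_lt_add fun e he => ?_
        obtain ⟨T, hT, h1⟩ := exists_isRule_lt_integral ν 0 hn he
        rw [hconst] at h1
        have h2 : 1 ≤ ∫ ω, (T (rewards ω) : ℝ) ∂(armLaw ν 0) := by
          have := integral_mono (integrable_const (μ := armLaw ν 0) (1 : ℝ))
            (Integrable.of_bound hT.measurable_cast.aestronglyMeasurable n
              (Filter.Eventually.of_forall hT.abs_le))
            fun ω => Nat.one_le_cast.2 (hT.one_le (rewards ω))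
          simpa using this
        by_contra hcon
        nlinarith
    rw [hconst, ← hG]
    simpa using hε
  have hv0 : (0 : ℝ) < v := by exact_mod_cast pos_iff_ne_zero.2 hv
  have hlow := le_mul_gittinsIndex_sub ν v (show 2 ≤ n from hn2)
  have hGν : 0 < G - ν := by
    have h1 : 0 < ((n : ℝ) - 1) * (v * (√(1 + v) * gaussianPosPart)) := by
      have : (0 : ℝ) < n - 1 := by linarith
      positivity
    have h2 := h1.trans_le hlow
    have h3 := (mul_pos_iff_of_pos_left (by positivity : (0 : ℝ) < 1 + v)).1 h2
    exact (mul_pos_iff_of_pos_left hn0).1 h3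
  -- The second bound ensures that the loss `(n ^ 2 + 1) * e` in `le_mul_setIntegral` takes at most
  -- half of `G - ν`.
  let e := min ε ((G - ν) / (2 * (n ^ 2 + 1)))
  have he : 0 < e := lt_min hε (by positivity)
  obtain ⟨T, hT, h1⟩ := exists_isRule_lt_integral ν v hn he
  refine ⟨T, hT, lt_of_le_of_lt (neg_le_neg (min_le_left _ _)) h1, ?_⟩
  have h2 := hT.le_mul_setIntegral hn he.le h1
  obtain ⟨B, hB, hBT⟩ := hT.exists_preimage_obs (k := n - 1) (by omega)
  have h3 := sq_setIntegral_fst_sub_le ν v hB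
  rw [hBT] at h3
  have h4 : (n ^ 2 + 1) * e ≤ (G - ν) / 2 := by
    calc ((n : ℝ) ^ 2 + 1) * e ≤ (n ^ 2 + 1) * ((G - ν) / (2 * (n ^ 2 + 1))) :=
          mul_le_mul_of_nonneg_left (min_le_right _ _) (by positivity)
      _ = (G - ν) / 2 := by field_simp
  have h5 : ∫ ω in {ω | T (rewards ω) = n}, (ω.1 - G) ∂(armLaw ν v) ≤
      ∫ ω in {ω | T (rewards ω) = n}, (ω.1 - ν) ∂(armLaw ν v) := by
    refine integral_mono
      ((integrable_fst_armLaw ν v).sub (integrable_const G)).integrableOn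
      ((integrable_fst_armLaw ν v).sub (integrable_const ν)).integrableOn fun ω => ?_
    simp only
    linarith
  set x := ∫ ω in {ω | T (rewards ω) = n}, (ω.1 - ν) ∂(armLaw ν v)
  set p := (armLaw ν v).real {ω | T (rewards ω) = n}
  have hcast : (((n - 1 : ℕ) : ℝ) + 1) = n := by
    rw [Nat.cast_sub hn]; simp
  rw [hcast] at h3
  have hx : (G - ν) / 2 ≤ n * x := by
    have : (G - ν) / 2 ≤ (n - 1) * x := by
      have := mul_le_mul_of_nonneg_left h5 (show (0 : ℝ) ≤ n - 1 by linarith)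
      linarith
    have hxpos : 0 ≤ x := by
      by_contra hneg
      nlinarith
    nlinarith
  have hs : 0 < √(1 + (v : ℝ)) := by positivity
  have hsq : √(1 + (v : ℝ)) ^ 2 = 1 + v := Real.sq_sqrt (by positivity)
  set s := √(1 + (v : ℝ))
  -- Combining the lower bound on `G - ν` with the upper bound by `2 * n * x`. After squaring and
  -- Cauchy–Schwarz the factors `v ^ 2` cancel, which makes the final bound independent of the
  -- prior.
  have h6 : v * gaussianPosPart ≤ 4 * (s * (n * x)) := by
    have h7 : ((n : ℝ) / 2) * (v * (s * gaussianPosPart)) ≤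
        (1 + v) * (n * (2 * (n * x))) := by
      refine le_trans (mul_le_mul_of_nonneg_right (by linarith) (by positivity)) (hlow.trans ?_)
      gcongr
      linarith
    rw [← hsq] at h7
    have h8 : (n * s / 2) * (v * gaussianPosPart) ≤
        (n * s / 2) * (4 * (s * (n * x))) := by nlinarith
    exact le_of_mul_le_mul_left h8 (by positivity)
  have h9 : (v * gaussianPosPart) ^ 2 ≤ 16 * n ^ 2 * ((v : ℝ) ^ 2 * n * p) := by
    calc (v * gaussianPosPart) ^ 2 ≤ (4 * (s * (n * x))) ^ 2 :=
          pow_le_pow_left₀ (by positivity) h6 2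
      _ = 16 * n ^ 2 * ((1 + v) * x ^ 2) := by rw [← hsq]; ring
      _ ≤ _ := mul_le_mul_of_nonneg_left h3 (by positivity)
  have h10 : gaussianPosPart ^ 2 ≤ 16 * n ^ 3 * p := by
    have : (v : ℝ) ^ 2 * gaussianPosPart ^ 2 ≤ (v : ℝ) ^ 2 * (16 * n ^ 3 * p) := by nlinarith
    exact le_of_mul_le_mul_left this (by positivity)
  rw [div_le_iff₀ (by positivity)]
  refine (min_le_left _ _).trans ?_
  linarith

end Value

/-! ### Nonanticipating pull counts and rules that may stop at time zero -/

namespace Strategy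

/-- The smaller value is reproduced at `y'`. If the other one dropped below it there,
nonanticipation read from `y'` back to `y` would make it that small at `y` too. -/
theorem NonAnticipating.min {S T : (ℕ → ℝ) → ℕ} (hS : NonAnticipating S)
    (hT : NonAnticipating T) : NonAnticipating fun y => min (S y) (T y) := by
  intro y y' hy
  simp only at hy ⊢
  rcases le_total (S y) (T y) with h | h
  · have h1 : S y' = S y := hS y y' fun k hk => hy k (by omega)
    by_contra hne
    have h2 := hT y' y fun k hk => (hy k (by omega)).symm
    omega
  · have h1 : T y' = T y := hT y y' fun k hk => hy k (by omega)
    by_contra hne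
    have h2 := hS y' y fun k hk => (hy k (by omega)).symm
    omega

theorem nonAnticipating_pulls (π : Strategy 2) (u : unitInterval) (r : ℕ → ℝ) (t : ℕ) :
    NonAnticipating fun y => pulls t (π.tableHistory u ![r, y] t) 1 := by
  intro y y' hy
  simp only at hy ⊢
  rw [π.tableHistory_congr u (r := ![r, y]) (r' := ![r, y']) t
    (Fin.forall_fin_two.2 ⟨fun k _ => rfl, fun k hk => hy k hk⟩)]

/-- The rule `T` if the strategy chooses arm `0` in the first round, and `0` otherwise. -/
def startRule (π : Strategy 2) (T : (ℕ → ℝ) → ℕ) (u : unitInterval) (y : ℕ → ℝ) : ℕ :=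
  if π.act 0 u Fin.elim0 = 0 then T y else 0

theorem measurableSet_act_zero (π : Strategy 2) :
    MeasurableSet {u | π.act 0 u Fin.elim0 = 0} :=
  π.measurable_act_uncurry 0 measurable_id measurable_const (measurableSet_singleton 0)

theorem measurable_startRule (π : Strategy 2) {T : (ℕ → ℝ) → ℕ} (hT : Measurable T) :
    Measurable fun p : unitInterval × (ℕ → ℝ) => π.startRule T p.1 p.2 := by
  unfold startRule
  exact Measurable.ite (measurable_fst π.measurableSet_act_zero) (hT.comp measurable_snd)
    measurable_const

theorem nonAnticipating_startRule (π : Strategy 2) {T : (ℕ → ℝ) → ℕ} (hT : NonAnticipating T)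
    (u : unitInterval) : NonAnticipating (π.startRule T u) := by
  intro y y' hy
  unfold startRule at hy ⊢
  split_ifs with h
  · exact hT y y' fun k hk => hy k (by rwa [if_pos h])
  · rfl

end Strategy

/-- At the Gittins index, no rule that may stop immediately has a positive value. -/
theorem integral_nonpos_of_nonAnticipating {ν : ℝ} {v : ℝ≥0} {n : ℕ} (hn : 1 ≤ n)
    {f : (ℕ → ℝ) → ℕ} (hf : Measurable f) (hna : Strategy.NonAnticipating f)
    (hle : ∀ y, f y ≤ n) :
    ∫ ω, (ω.1 - gittinsIndex ν v n) * (f (rewards ω) : ℝ) ∂(armLaw ν v) ≤ 0 := by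
  by_cases h : ∃ y, f y = 0
  · obtain ⟨y, hy⟩ := h
    -- A nonanticipating function that vanishes somewhere has used no observation, hence vanishes
    -- everywhere.
    have : ∀ y', f y' = 0 := fun y' => (hna y y' fun k hk => by omega).trans hy
    simp [this]
  · push Not at h
    exact IsRule.integral_nonpos ⟨hf, hna, fun y => Nat.one_le_iff_ne_zero.2 (h y), hle⟩ hn

/-! ### The regret in terms of reward tables -/

theorem iSup_fin_two_eq_max (θ : Fin 2 → ℝ) : ⨆ i, θ i = max (θ 0) (θ 1) := by
  refine le_antisymm (ciSup_le (Fin.forall_fin_two.2 ⟨le_max_left _ _, le_max_right _ _⟩)) ?_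
  have hb : BddAbove (Set.range θ) := (Set.finite_range θ).bddAbove
  exact max_le (le_ciSup hb 0) (le_ciSup hb 1)

theorem map_noise_prod_noise :
    (noise.prod noise).map (fun q (j : Fin 2 × ℕ) => (![q.1, q.2] : Fin 2 → ℕ → ℝ) j.1 j.2) =
      iidGaussian (Fin 2 × ℕ) := by
  have h1 := Measure.infinitePi_map_curry_symm (ι := Fin 2) (κ := ℕ) (X := ℝ)
    (fun _ _ => gaussianReal 0 1)
  have h2 := (measurePreserving_piFinTwo fun _ : Fin 2 => noise).symm
  change Measure.map (MeasurableEquiv.curry (Fin 2) ℕ ℝ).symm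
    (Measure.infinitePi fun _ : Fin 2 => noise) = iidGaussian (Fin 2 × ℕ) at h1
  rw [Measure.infinitePi_eq_pi, ← h2.map_eq,
    Measure.map_map (MeasurableEquiv.measurable _) (MeasurableEquiv.measurable _)] at h1
  rw [← h1]
  congr 1

namespace Strategy

/-- The number of pulls of arm `1` in the first `n` rounds, when arm `0` yields the rewards `r₀`
and arm `1` the rewards `r₁`. -/
def pullsOne (π : Strategy 2) (n : ℕ) (u : unitInterval) (r₀ r₁ : ℕ → ℝ) : ℕ :=
  pulls n (π.tableHistory u ![r₀, r₁] n) 1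

theorem pullsOne_le (π : Strategy 2) (n : ℕ) (u : unitInterval) (r₀ r₁ : ℕ → ℝ) :
    π.pullsOne n u r₀ r₁ ≤ n := π.pulls_tableHistory_le u _ n 1

theorem pullsOne_lt (π : Strategy 2) {n : ℕ} (hn : 1 ≤ n) {u : unitInterval}
    (hu : π.act 0 u Fin.elim0 = 0) (r₀ r₁ : ℕ → ℝ) : π.pullsOne n u r₀ r₁ < n := by
  have h1 := π.monotone_pulls_tableHistory u ![r₀, r₁] 0 hn
  have h2 := pulls_zero_add_pulls_one n (π.tableHistory u ![r₀, r₁] n)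
  have h3 : pulls 1 (π.tableHistory u ![r₀, r₁] 1) 0 = 1 := by
    rw [pulls_tableHistory_succ]
    have : π.act 0 u (π.tableHistory u ![r₀, r₁] 0) = 0 := hu
    simp [this, pulls]
  simp only [h3] at h1
  unfold pullsOne
  omega

theorem measurable_pullsOne (π : Strategy 2) (n : ℕ) {α : Type*} [MeasurableSpace α]
    {f : α → unitInterval} {g h : α → ℕ → ℝ} (hf : Measurable f) (hg : Measurable g)
    (hh : Measurable h) : Measurable fun a => π.pullsOne n (f a) (g a) (h a) := by
  refine (measurable_pulls n 1).comp ((π.measurable_tableHistory n).comp (hf.prodMk ?_))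
  refine measurable_pi_lambda _ fun i => ?_
  revert i
  exact Fin.forall_fin_two.2 ⟨hg, hh⟩

/-- With two arms the regret is affine in the number of pulls of arm 1, so only the law of that
count matters. -/
theorem sum_regret_eq (π : Strategy 2) (u : unitInterval) (θ : Fin 2 → ℝ) (ε : ℕ → ℝ) (s : ℝ)
    (n : ℕ) : ∑ t ∈ Finset.range n, (s - θ (π.arm u θ ε t)) =
      n * (s - θ 0) - (θ 1 - θ 0) * pulls n (π.history u θ ε n) 1 := by
  induction n with
  | zero => simp [pulls]
  | succ n ih =>
    rw [Finset.sum_range_succ, ih]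
    rw [history, pulls_snoc, arm]
    rcases Fin.exists_fin_two.1 ⟨π.act n u (π.history u θ ε n), rfl⟩ with h | h <;>
      simp only [h] <;> simp <;> ring

theorem integral_pulls_eq (π : Strategy 2) (n : ℕ) (u : unitInterval) (θ : Fin 2 → ℝ) :
    ∫ ε, (pulls n (π.history u θ ε n) 1 : ℝ) ∂noise =
      ∫ q, (π.pullsOne n u (rewards (θ 0, q.1)) (rewards (θ 1, q.2)) : ℝ)
        ∂(noise.prod noise) := by
  have hp : Measurable fun h : Fin n → Fin 2 × ℝ => (pulls n h 1 : ℝ) :=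
    measurable_from_top.comp (measurable_pulls n 1)
  have m1 : Measurable fun ε => π.history u θ ε n :=
    (π.measurable_history n).comp (measurable_const.prodMk (measurable_const.prodMk measurable_id))
  have m2 : Measurable fun x : Fin 2 × ℕ → ℝ =>
      π.tableHistory u (fun i k => θ i + x (i, k)) n :=
    (π.measurable_tableHistory n).comp (measurable_const.prodMk
      (measurable_pi_lambda _ fun i => measurable_pi_lambda _ fun k =>
        (measurable_pi_apply (i, k)).const_add _))
  have m3 : Measurable fun (q : (ℕ → ℝ) × (ℕ → ℝ)) (j : Fin 2 × ℕ) =>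
      (![q.1, q.2] : Fin 2 → ℕ → ℝ) j.1 j.2 := by
    refine measurable_pi_lambda _ ?_
    rintro ⟨i, k⟩
    revert i
    exact Fin.forall_fin_two.2 ⟨(measurable_pi_apply k).comp measurable_fst,
      (measurable_pi_apply k).comp measurable_snd⟩
  rw [← integral_map (μ := noise) m1.aemeasurable hp.aestronglyMeasurable, π.map_history_eq,
    ← map_noise_prod_noise, Measure.map_map m2 m3,
    integral_map (m2.comp m3).aemeasurable hp.aestronglyMeasurable]
  refine integral_congr_ae (Filter.Eventually.of_forall fun q => ?_)
  have : (fun i k => θ i + (![q.1, q.2] : Fin 2 → ℕ → ℝ) i k) =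
      ![rewards (θ 0, q.1), rewards (θ 1, q.2)] := by
    ext i k
    revert i
    exact Fin.forall_fin_two.2 ⟨rfl, rfl⟩
  simp only [Function.comp_apply, this]
  rfl

theorem measurable_pullsOne_rewards (π : Strategy 2) (n : ℕ) :
    Measurable fun p : (Fin 2 → ℝ) × unitInterval × (ℕ → ℝ) × (ℕ → ℝ) =>
      (π.pullsOne n p.2.1 (rewards (p.1 0, p.2.2.1)) (rewards (p.1 1, p.2.2.2)) : ℝ) := by
  have h : ∀ i : Fin 2, Measurable fun p : (Fin 2 → ℝ) × unitInterval × (ℕ → ℝ) × (ℕ → ℝ) =>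
    p.1 i := fun i => (measurable_pi_apply i).comp measurable_fst
  exact measurable_from_top.comp (π.measurable_pullsOne n measurable_snd.fst
    (measurable_rewards.comp ((h 0).prodMk measurable_snd.snd.fst))
    (measurable_rewards.comp ((h 1).prodMk measurable_snd.snd.snd)))

theorem regret_eq (π : Strategy 2) (n : ℕ) (θ : Fin 2 → ℝ) :
    π.regret n θ = n * (max (θ 0) (θ 1) - θ 0) - (θ 1 - θ 0) *
      ∫ p, (π.pullsOne n p.1 (rewards (θ 0, p.2.1)) (rewards (θ 1, p.2.2)) : ℝ)
        ∂((volume : Measure unitInterval).prod (noise.prod noise)) := by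
  have hb : ∀ {t : ℕ} (h : Fin t → Fin 2 × ℝ), ‖(pulls t h 1 : ℝ)‖ ≤ t := fun {t} h => by
    rw [Real.norm_of_nonneg (Nat.cast_nonneg _)]
    have := pulls_zero_add_pulls_one t h
    exact_mod_cast (by omega : pulls t h 1 ≤ t)
  have m1 : Measurable fun p : unitInterval × (ℕ → ℝ) => (pulls n (π.history p.1 θ p.2 n) 1 : ℝ) :=
    measurable_from_top.comp ((measurable_pulls n 1).comp ((π.measurable_history n).comp
      (measurable_fst.prodMk (measurable_const.prodMk measurable_snd))))
  have m2 := (π.measurable_pullsOne_rewards n).comp (measurable_prodMk_left (x := θ))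
  have i1 : Integrable (fun p : unitInterval × (ℕ → ℝ) => (pulls n (π.history p.1 θ p.2 n) 1 : ℝ))
      ((volume : Measure unitInterval).prod noise) :=
    Integrable.of_bound m1.aestronglyMeasurable n (Filter.Eventually.of_forall fun p => hb _)
  have i2 : Integrable (fun p : unitInterval × (ℕ → ℝ) × (ℕ → ℝ) =>
      (π.pullsOne n p.1 (rewards (θ 0, p.2.1)) (rewards (θ 1, p.2.2)) : ℝ))
      ((volume : Measure unitInterval).prod (noise.prod noise)) :=
    Integrable.of_bound m2.aestronglyMeasurable n (Filter.Eventually.of_forall fun p => hb _)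
  unfold regret
  simp_rw [sum_regret_eq, iSup_fin_two_eq_max]
  rw [integral_sub (integrable_const _) (i1.const_mul _), integral_const_mul (θ 1 - θ 0), integral_prod _ i1,
    integral_prod _ i2]
  simp_rw [integral_pulls_eq]
  simp

end Strategy

/-! ### The joint law of the seed and the two arms -/

theorem integrable_eval_gaussianPrior {d : ℕ} (ν : Fin d → ℝ) (v : Fin d → ℝ≥0) (i : Fin d) :
    Integrable (fun θ => θ i) (gaussianPrior ν v) := by
  have h := measurePreserving_eval (fun i => gaussianReal (ν i) (v i)) i
  have hi : Integrable id (gaussianReal (ν i) (v i)) :=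
    (memLp_id_gaussianReal 1).integrable le_rfl
  exact h.integrable_comp_of_integrable hi

instance {d : ℕ} (ν : Fin d → ℝ) (v : Fin d → ℝ≥0) :
    IsProbabilityMeasure (gaussianPrior ν v) := by unfold gaussianPrior; infer_instance

theorem Strategy.integrable_regret (π : Strategy 2) (n : ℕ) (ν : Fin 2 → ℝ) (v : Fin 2 → ℝ≥0) :
    Integrable (fun θ => π.regret n θ) (gaussianPrior ν v) := by
  have h0 := integrable_eval_gaussianPrior ν v 0
  have h1 := integrable_eval_gaussianPrior ν v 1
  simp_rw [regret_eq]
  have hm : StronglyMeasurable fun θ : Fin 2 → ℝ =>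
      ∫ p, (π.pullsOne n p.1 (rewards (θ 0, p.2.1)) (rewards (θ 1, p.2.2)) : ℝ)
        ∂((volume : Measure unitInterval).prod (noise.prod noise)) :=
    (π.measurable_pullsOne_rewards n).stronglyMeasurable.integral_prod_right
  refine (((h0.sup h1).sub h0).const_mul _).sub
    ((h1.sub h0).mul_bdd (c := n) hm.aestronglyMeasurable (Filter.Eventually.of_forall fun θ => ?_))
  refine (norm_integral_le_of_norm_le_const (C := n) (Filter.Eventually.of_forall fun p => ?_)).trans
    (by simp)
  rw [Real.norm_of_nonneg (Nat.cast_nonneg _)]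
  exact_mod_cast π.pullsOne_le n _ _ _

/-- The law of the seed and of the mean and noise of both arms. -/
def jointLaw (ν : Fin 2 → ℝ) (v : Fin 2 → ℝ≥0) :
    Measure ((unitInterval × ℝ × (ℕ → ℝ)) × ℝ × (ℕ → ℝ)) :=
  ((volume : Measure unitInterval).prod (armLaw (ν 0) (v 0))).prod (armLaw (ν 1) (v 1))

instance (ν : Fin 2 → ℝ) (v : Fin 2 → ℝ≥0) : IsProbabilityMeasure (jointLaw ν v) := by
  unfold jointLaw; infer_instance

/-- Regroups the means, the seed and the noises so that arm 1 becomes a separate independent factor;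
the rest can then be frozen by Fubini. -/
theorem measurePreserving_shuffle {A B U X Y : Type*} [MeasurableSpace A] [MeasurableSpace B]
    [MeasurableSpace U] [MeasurableSpace X] [MeasurableSpace Y] (a : Measure A) (b : Measure B)
    (u : Measure U) (x : Measure X) (y : Measure Y) [SFinite a] [SFinite b] [SFinite u] [SFinite x]
    [SFinite y] :
    MeasurePreserving (fun p : (A × B) × U × X × Y => ((p.2.1, p.1.1, p.2.2.1), p.1.2, p.2.2.2))
      ((a.prod b).prod (u.prod (x.prod y))) ((u.prod (a.prod x)).prod (b.prod y)) := by
  have hm : Measurable (fun p : (A × B) × U × X × Y =>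
    ((p.2.1, p.1.1, p.2.2.1), p.1.2, p.2.2.2)) := by fun_prop
  refine ⟨hm, Measure.ext_of_lintegral _ fun f hf => ?_⟩
  have hfm : Measurable fun p : (A × B) × U × X × Y =>
    f ((p.2.1, p.1.1, p.2.2.1), p.1.2, p.2.2.2) := hf.comp hm
  rw [lintegral_map hf hm, lintegral_prod _ hfm.aemeasurable,
    lintegral_prod _ (by fun_prop), lintegral_prod _ (by fun_prop), lintegral_prod _ (by fun_prop)]
  have e1 : ∀ s t, ∫⁻ q, f ((q.1, s, q.2.1), t, q.2.2) ∂(u.prod (x.prod y)) =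
      ∫⁻ c, ∫⁻ p, ∫⁻ q, f ((c, s, p), t, q) ∂y ∂x ∂u := fun s t => by
    rw [lintegral_prod _ (by fun_prop)]
    refine lintegral_congr fun c => ?_
    rw [lintegral_prod _ (by fun_prop)]
  have e2 : ∀ c, ∫⁻ q, ∫⁻ z, f ((c, q), z) ∂(b.prod y) ∂(a.prod x) =
      ∫⁻ s, ∫⁻ p, ∫⁻ t, ∫⁻ q, f ((c, s, p), t, q) ∂y ∂b ∂x ∂a := fun c => by
    rw [lintegral_prod _ (by fun_prop)]
    refine lintegral_congr fun s => lintegral_congr fun p => ?_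
    rw [lintegral_prod _ (by fun_prop)]
  simp only [e1, e2]
  rw [lintegral_lintegral_swap (μ := u) (ν := a) (by fun_prop)]
  refine lintegral_congr fun s => ?_
  rw [lintegral_lintegral_swap (by fun_prop)]
  refine lintegral_congr fun c => ?_
  rw [lintegral_lintegral_swap (by fun_prop)]

theorem measurePreserving_jointLaw (ν : Fin 2 → ℝ) (v : Fin 2 → ℝ≥0) :
    MeasurePreserving (fun p : (Fin 2 → ℝ) × unitInterval × (ℕ → ℝ) × (ℕ → ℝ) =>
      ((p.2.1, p.1 0, p.2.2.1), p.1 1, p.2.2.2))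
      ((gaussianPrior ν v).prod ((volume : Measure unitInterval).prod (noise.prod noise)))
      (jointLaw ν v) :=
  (measurePreserving_shuffle (gaussianReal (ν 0) (v 0)) (gaussianReal (ν 1) (v 1)) volume noise
    noise).comp ((measurePreserving_piFinTwo fun i => gaussianReal (ν i) (v i)).prod
      (MeasurePreserving.id _))

/-- A Gaussian tail bound. -/
theorem integral_max_sub_le (ν : ℝ) (v : ℝ≥0) {G L : ℝ} (hL : 0 < L) (hG : ν < G)
    (h : v * L ≤ (G - ν) ^ 2) :
    ∫ x, max (x - G) 0 ∂(gaussianReal ν v) ≤ (G - ν) / L * Real.exp (-(L / 2)) := by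
  have hΔ : 0 < G - ν := sub_pos.2 hG
  -- Chernoff's bound with the parameter that makes the linear term `t * (G - ν)` equal to `L`,
  -- while the hypothesis on `v` keeps the quadratic term below `L / 2`. The positive part is
  -- controlled by `y ≤ exp (t * y) / t`.
  set t := L / (G - ν)
  have ht : 0 < t := by positivity
  have hi : Integrable (fun x : ℝ => Real.exp (t * x)) (gaussianReal ν v) :=
    integrable_exp_mul_gaussianReal t
  have hi1 : Integrable (fun x : ℝ => max (x - G) 0) (gaussianReal ν v) :=
    (((memLp_id_gaussianReal 1).integrable le_rfl).sub (integrable_const G)).pos_part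
  have hle : ∀ x : ℝ, max (x - G) 0 ≤ Real.exp (-(t * G)) / t * Real.exp (t * x) := by
    intro x
    have e : Real.exp (-(t * G)) / t * Real.exp (t * x) = Real.exp (t * (x - G)) / t := by
      rw [div_mul_eq_mul_div, ← Real.exp_add]; ring_nf
    rw [e]
    refine max_le ?_ (by positivity)
    rw [le_div_iff₀ ht]
    linarith [Real.add_one_le_exp (t * (x - G))]
  have hmgf : ∫ x, Real.exp (t * x) ∂(gaussianReal ν v) = Real.exp (ν * t + v * t ^ 2 / 2) :=
    congrFun mgf_fun_id_gaussianReal t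
  calc ∫ x, max (x - G) 0 ∂(gaussianReal ν v)
      ≤ ∫ x, Real.exp (-(t * G)) / t * Real.exp (t * x) ∂(gaussianReal ν v) :=
        integral_mono hi1 (hi.const_mul _) hle
    _ = 1 / t * Real.exp (-(t * (G - ν)) + v * t ^ 2 / 2) := by
        rw [integral_const_mul, hmgf, div_mul_eq_mul_div, ← Real.exp_add, one_div_mul_eq_div]
        ring_nf
    _ ≤ (G - ν) / L * Real.exp (-(L / 2)) := by
        have h1 : 1 / t = (G - ν) / L := by simp only [t]; rw [one_div_div]
        have h2 : t * (G - ν) = L := div_mul_cancel₀ _ hΔ.ne'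
        have h3 : v * t ^ 2 ≤ L := by
          have : v * t ^ 2 = v * L * L / (G - ν) ^ 2 := by simp only [t]; field_simp
          rw [this, div_le_iff₀ (by positivity)]
          nlinarith
        rw [h1, h2]
        gcongr
        linarith

/-! ### The regret saved by exploring arm 1 first -/

namespace Strategy

/-- The number of pulls of arm `1` that `exploreFirst` adds to those of `π`. -/
def extraPulls (π : Strategy 2) (n : ℕ) (T : (ℕ → ℝ) → ℕ)
    (p : (unitInterval × ℝ × (ℕ → ℝ)) × ℝ × (ℕ → ℝ)) : ℝ :=
  (π.startRule T p.1.1 (rewards p.2) : ℝ) - (min (π.startRule T p.1.1 (rewards p.2))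
    (π.pullsOne n p.1.1 (rewards p.1.2) (rewards p.2)) : ℕ)

variable (π : Strategy 2) {n : ℕ} {T : (ℕ → ℝ) → ℕ}

theorem startRule_le (hT : IsRule n T) (u : unitInterval) (y : ℕ → ℝ) : π.startRule T u y ≤ n := by
  have := hT.le y
  unfold startRule
  split_ifs <;> omega

theorem measurable_startRule_rewards (hT : IsRule n T) :
    Measurable fun p : (unitInterval × ℝ × (ℕ → ℝ)) × ℝ × (ℕ → ℝ) =>
      π.startRule T p.1.1 (rewards p.2) :=
  (π.measurable_startRule hT.measurable).comp
    (measurable_fst.fst.prodMk (measurable_rewards.comp measurable_snd))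

theorem measurable_min_pullsOne (hT : IsRule n T) :
    Measurable fun p : (unitInterval × ℝ × (ℕ → ℝ)) × ℝ × (ℕ → ℝ) =>
      min (π.startRule T p.1.1 (rewards p.2))
        (π.pullsOne n p.1.1 (rewards p.1.2) (rewards p.2)) :=
  (π.measurable_startRule_rewards hT).min (π.measurable_pullsOne n measurable_fst.fst
    (measurable_rewards.comp measurable_fst.snd) (measurable_rewards.comp measurable_snd))

theorem measurable_extraPulls (hT : IsRule n T) : Measurable (π.extraPulls n T) :=
  (measurable_from_top.comp (π.measurable_startRule_rewards hT)).sub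
    (measurable_from_top.comp (π.measurable_min_pullsOne hT))

theorem extraPulls_nonneg (p : (unitInterval × ℝ × (ℕ → ℝ)) × ℝ × (ℕ → ℝ)) :
    0 ≤ π.extraPulls n T p :=
  sub_nonneg.2 (by exact_mod_cast min_le_left _ _)

theorem extraPulls_le (hT : IsRule n T) (p : (unitInterval × ℝ × (ℕ → ℝ)) × ℝ × (ℕ → ℝ)) :
    π.extraPulls n T p ≤ n := by
  have h1 : (π.startRule T p.1.1 (rewards p.2) : ℝ) ≤ n := by
    exact_mod_cast π.startRule_le hT _ _
  have h2 := Nat.cast_nonneg (α := ℝ) (min (π.startRule T p.1.1 (rewards p.2))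
    (π.pullsOne n p.1.1 (rewards p.1.2) (rewards p.2)))
  unfold extraPulls
  linarith

theorem norm_extraPulls_le (hT : IsRule n T)
    (p : (unitInterval × ℝ × (ℕ → ℝ)) × ℝ × (ℕ → ℝ)) : ‖π.extraPulls n T p‖ ≤ n := by
  rw [Real.norm_of_nonneg (π.extraPulls_nonneg p)]
  exact π.extraPulls_le hT p

/-- This is `max N T - N = T - min N T`; the truncation of `T` at the horizon disappears because `T
≤ n`. -/
theorem pullsOne_exploreFirst_sub (hT : IsRule n T)
    (p : (unitInterval × ℝ × (ℕ → ℝ)) × ℝ × (ℕ → ℝ)) :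
    ((π.exploreFirst (π.startRule T) (π.measurable_startRule hT.measurable)).pullsOne n p.1.1
      (rewards p.1.2) (rewards p.2) : ℝ) - π.pullsOne n p.1.1 (rewards p.1.2) (rewards p.2) =
      π.extraPulls n T p := by
  have h := π.pulls_exploreFirst (π.measurable_startRule hT.measurable)
    (π.nonAnticipating_startRule hT.nonAnticipating p.1.1) ![rewards p.1.2, rewards p.2] n
  have h2 := π.startRule_le hT p.1.1 (rewards p.2)
  have h3 : (![rewards p.1.2, rewards p.2] : Fin 2 → ℕ → ℝ) 1 = rewards p.2 := rfl
  rw [h3, min_eq_right h2] at h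
  unfold extraPulls pullsOne
  rw [h, sub_eq_sub_iff_add_eq_add]
  norm_cast
  rw [max_comm, max_add_min]

theorem bayesRegret_sub_exploreFirst (hT : IsRule n T) (ν : Fin 2 → ℝ) (v : Fin 2 → ℝ≥0) :
    π.bayesRegret n (gaussianPrior ν v) -
      (π.exploreFirst (π.startRule T) (π.measurable_startRule hT.measurable)).bayesRegret n
        (gaussianPrior ν v) =
      ∫ p, (p.2.1 - p.1.2.1) * π.extraPulls n T p ∂(jointLaw ν v) := by
  set σ := π.exploreFirst (π.startRule T) (π.measurable_startRule hT.measurable)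
  have hmp := measurePreserving_jointLaw ν v
  have hm : Measurable fun p : (unitInterval × ℝ × (ℕ → ℝ)) × ℝ × (ℕ → ℝ) =>
      (p.2.1 - p.1.2.1) * π.extraPulls n T p :=
    (measurable_snd.fst.sub measurable_fst.snd.fst).mul (π.measurable_extraPulls hT)
  have hdiff : Integrable (fun θ => θ 1 - θ 0) (gaussianPrior ν v) :=
    (integrable_eval_gaussianPrior ν v 1).sub (integrable_eval_gaussianPrior ν v 0)
  have hi : Integrable (fun q : (Fin 2 → ℝ) × unitInterval × (ℕ → ℝ) × (ℕ → ℝ) =>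
      (q.1 1 - q.1 0) * π.extraPulls n T ((q.2.1, q.1 0, q.2.2.1), q.1 1, q.2.2.2))
      ((gaussianPrior ν v).prod ((volume : Measure unitInterval).prod (noise.prod noise))) :=
    (hdiff.comp_fst _).mul_bdd ((π.measurable_extraPulls hT).comp
      hmp.measurable).aestronglyMeasurable
      (Filter.Eventually.of_forall fun _ => π.norm_extraPulls_le hT _)
  have hbound : ∀ (ρ : Strategy 2) (θ : Fin 2 → ℝ), Integrable
      (fun p : unitInterval × (ℕ → ℝ) × (ℕ → ℝ) =>
        (ρ.pullsOne n p.1 (rewards (θ 0, p.2.1)) (rewards (θ 1, p.2.2)) : ℝ))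
      ((volume : Measure unitInterval).prod (noise.prod noise)) := fun ρ θ =>
    Integrable.of_bound ((ρ.measurable_pullsOne_rewards n).comp
      (measurable_prodMk_left (x := θ))).aestronglyMeasurable n
      (Filter.Eventually.of_forall fun p => by
        rw [Real.norm_of_nonneg (Nat.cast_nonneg _)]
        exact_mod_cast ρ.pullsOne_le n _ _ _)
  unfold bayesRegret
  rw [← integral_sub (π.integrable_regret n ν v) (σ.integrable_regret n ν v), ← hmp.map_eq,
    integral_map hmp.measurable.aemeasurable hm.aestronglyMeasurable, integral_prod _ hi]
  refine integral_congr_ae (Filter.Eventually.of_forall fun θ => ?_)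
  simp only
  rw [integral_const_mul, regret_eq, regret_eq, sub_sub_sub_cancel_left, ← mul_sub,
    ← integral_sub (hbound σ θ) (hbound π θ)]
  congr 1
  refine integral_congr_ae (Filter.Eventually.of_forall fun p => ?_)
  exact π.pullsOne_exploreFirst_sub hT ((p.1, θ 0, p.2.1), θ 1, p.2.2)

/-- On seeds that start with arm 0, the number of extra pulls lies between 1 and `n` if `T = n`, and
between 0 and `n - 1` otherwise. Beyond the one pull guaranteed by `T = n`, at most `n - 1` remain,
each losing at most `(μ₀ - G)⁺`. On the other seeds both sides vanish. -/
theorem extraPulls_mul_ge (hT : IsRule n T) (hn : 1 ≤ n) (G : ℝ)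
    (p : (unitInterval × ℝ × (ℕ → ℝ)) × ℝ × (ℕ → ℝ)) :
    ({u | π.act 0 u Fin.elim0 = 0}.indicator 1 p.1.1 * (G - p.1.2.1)) *
        {ω | T (rewards ω) = n}.indicator 1 p.2 -
      (n - 1) * ({u | π.act 0 u Fin.elim0 = 0}.indicator 1 p.1.1 * max (p.1.2.1 - G) 0) ≤
      (G - p.1.2.1) * π.extraPulls n T p := by
  set x := p.1.2.1
  have h0 := π.extraPulls_nonneg (n := n) (T := T) p
  have h1 := le_max_left (x - G) 0
  have h2 := le_max_right (x - G) 0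
  by_cases hu : π.act 0 p.1.1 Fin.elim0 = 0
  · have hs : π.startRule T p.1.1 (rewards p.2) = T (rewards p.2) := by simp [startRule, hu]
    have hlt := π.pullsOne_lt hn hu (rewards p.1.2) (rewards p.2)
    by_cases hTn : T (rewards p.2) = n
    · have h3 : 1 ≤ π.extraPulls n T p := by
        unfold extraPulls
        rw [hs, hTn, min_eq_right hlt.le, le_sub_iff_add_le]
        exact_mod_cast (by omega)
      have h4 := π.extraPulls_le hT p
      simp only [Set.indicator_of_mem (show p.1.1 ∈ {u | π.act 0 u Fin.elim0 = 0} from hu),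
        Set.indicator_of_mem (show p.2 ∈ {ω | T (rewards ω) = n} from hTn), Pi.one_apply]
      nlinarith
    · have h4 : π.extraPulls n T p ≤ n - 1 := by
        have h5 := hT.le (rewards p.2)
        unfold extraPulls
        rw [hs]
        have h6 : (T (rewards p.2) : ℝ) ≤ n - 1 := by
          rw [le_sub_iff_add_le]
          exact_mod_cast (by omega : T (rewards p.2) + 1 ≤ n)
        have := Nat.cast_nonneg (α := ℝ)
          (min (T (rewards p.2)) (π.pullsOne n p.1.1 (rewards p.1.2) (rewards p.2)))
        linarith
      simp only [Set.indicator_of_mem (show p.1.1 ∈ {u | π.act 0 u Fin.elim0 = 0} from hu),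
        Set.indicator_of_notMem (show p.2 ∉ {ω | T (rewards ω) = n} from hTn), Pi.one_apply]
      nlinarith
  · have hz : π.extraPulls n T p = 0 := by simp [extraPulls, startRule, hu]
    simp [hz, Set.indicator_of_notMem (show p.1.1 ∉ {u | π.act 0 u Fin.elim0 = 0} from hu)]

/-- The gain of exploring arm `1` first. -/
theorem le_integral_extraPulls (hT : IsRule n T) (hn : 1 ≤ n) (ν : Fin 2 → ℝ) (v : Fin 2 → ℝ≥0) :
    (volume : Measure unitInterval).real {u | π.act 0 u Fin.elim0 = 0} *
      ((∫ ω, (ω.1 - gittinsIndex (ν 1) (v 1) n) * (T (rewards ω) : ℝ) ∂(armLaw (ν 1) (v 1))) +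
        (gittinsIndex (ν 1) (v 1) n - ν 0) *
          (armLaw (ν 1) (v 1)).real {ω | T (rewards ω) = n} -
        (n - 1) * ∫ x, max (x - gittinsIndex (ν 1) (v 1) n) 0 ∂(gaussianReal (ν 0) (v 0))) ≤
      ∫ p, (p.2.1 - p.1.2.1) * π.extraPulls n T p ∂(jointLaw ν v) := by
  set G := gittinsIndex (ν 1) (v 1) n
  set U := {u | π.act 0 u Fin.elim0 = 0}
  have hU : MeasurableSet U := π.measurableSet_act_zero
  have hA := hT.measurableSet_eq n
  have i1 : Integrable (fun p : (unitInterval × ℝ × (ℕ → ℝ)) × ℝ × (ℕ → ℝ) => p.2.1 - G)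
      (jointLaw ν v) :=
    ((integrable_fst_armLaw (ν 1) (v 1)).sub (integrable_const G)).comp_snd _
  have i0' : Integrable (fun η : unitInterval × ℝ × (ℕ → ℝ) => G - η.2.1)
      ((volume : Measure unitInterval).prod (armLaw (ν 0) (v 0))) :=
    ((integrable_const G).sub (integrable_fst_armLaw (ν 0) (v 0))).comp_snd _
  have i0 : Integrable (fun p : (unitInterval × ℝ × (ℕ → ℝ)) × ℝ × (ℕ → ℝ) => G - p.1.2.1)
      (jointLaw ν v) := i0'.comp_fst _
  have bdd : ∀ {m : ℕ}, m ≤ n → ‖(m : ℝ)‖ ≤ n := fun h => by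
    rw [Real.norm_of_nonneg (Nat.cast_nonneg _)]; exact_mod_cast h
  have iS : Integrable (fun p : (unitInterval × ℝ × (ℕ → ℝ)) × ℝ × (ℕ → ℝ) =>
      (p.2.1 - G) * (π.startRule T p.1.1 (rewards p.2) : ℝ)) (jointLaw ν v) :=
    i1.mul_bdd (measurable_from_top.comp
      (π.measurable_startRule_rewards hT)).aestronglyMeasurable
      (Filter.Eventually.of_forall fun p => bdd (π.startRule_le hT _ _))
  have iM : Integrable (fun p : (unitInterval × ℝ × (ℕ → ℝ)) × ℝ × (ℕ → ℝ) =>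
      (p.2.1 - G) * ((min (π.startRule T p.1.1 (rewards p.2))
        (π.pullsOne n p.1.1 (rewards p.1.2) (rewards p.2)) : ℕ) : ℝ)) (jointLaw ν v) :=
    i1.mul_bdd (measurable_from_top.comp
      (π.measurable_min_pullsOne hT)).aestronglyMeasurable
      (Filter.Eventually.of_forall fun p => bdd
        ((min_le_left _ _).trans (π.startRule_le hT p.1.1 (rewards p.2))))
  have iD : Integrable (fun p => (G - p.1.2.1) * π.extraPulls n T p) (jointLaw ν v) :=
    i0.mul_bdd (π.measurable_extraPulls hT).aestronglyMeasurable
      (Filter.Eventually.of_forall fun p => π.norm_extraPulls_le hT p)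
  -- Inserting `G` between the two means separates the stopping problem for arm 1 from the
  -- comparison of arm 0 with `G`.
  have hsplit : ∫ p, (p.2.1 - p.1.2.1) * π.extraPulls n T p ∂(jointLaw ν v) =
      (∫ p, (p.2.1 - G) * (π.startRule T p.1.1 (rewards p.2) : ℝ) ∂(jointLaw ν v)) -
      (∫ p, (p.2.1 - G) * ((min (π.startRule T p.1.1 (rewards p.2))
        (π.pullsOne n p.1.1 (rewards p.1.2) (rewards p.2)) : ℕ) : ℝ) ∂(jointLaw ν v)) +
      ∫ p, (G - p.1.2.1) * π.extraPulls n T p ∂(jointLaw ν v) := by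
    rw [← integral_sub iS iM]
    refine Eq.trans ?_ (integral_add (iS.sub iM) iD)
    refine integral_congr_ae (Filter.Eventually.of_forall fun p => ?_)
    simp only [extraPulls]
    ring
  have hseed : ∀ g : ℝ × (ℕ → ℝ) → ℝ, ∫ η : unitInterval × ℝ × (ℕ → ℝ), U.indicator 1 η.1 * g η.2
      ∂((volume : Measure unitInterval).prod (armLaw (ν 0) (v 0))) =
      (volume : Measure unitInterval).real U * ∫ ω, g ω ∂(armLaw (ν 0) (v 0)) := fun g => by
    rw [integral_prod_mul (μ := (volume : Measure unitInterval)) (U.indicator 1) g,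
      integral_indicator_one hU]
  have hfst : ∫ p, (p.2.1 - G) * (π.startRule T p.1.1 (rewards p.2) : ℝ) ∂(jointLaw ν v) =
      (volume : Measure unitInterval).real U *
        ∫ ω, (ω.1 - G) * (T (rewards ω) : ℝ) ∂(armLaw (ν 1) (v 1)) := by
    have e : ∀ p : (unitInterval × ℝ × (ℕ → ℝ)) × ℝ × (ℕ → ℝ),
        (p.2.1 - G) * (π.startRule T p.1.1 (rewards p.2) : ℝ) =
          (U.indicator 1 p.1.1 * 1) * ((p.2.1 - G) * (T (rewards p.2) : ℝ)) := by
      intro p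
      by_cases h : π.act 0 p.1.1 Fin.elim0 = 0
      · rw [Set.indicator_of_mem (show p.1.1 ∈ U from h)]; simp [startRule, h]
      · rw [Set.indicator_of_notMem (show p.1.1 ∉ U from h)]; simp [startRule, h]
    simp_rw [e]
    rw [jointLaw, integral_prod_mul (fun η : unitInterval × ℝ × (ℕ → ℝ) => U.indicator 1 η.1 * 1)
      (fun ω : ℝ × (ℕ → ℝ) => (ω.1 - G) * (T (rewards ω) : ℝ)), hseed fun _ => 1]
    simp
  -- With the seed and arm 0 frozen, the minimum is a nonanticipating function of the rewards of arm
  -- 1, so the Gittins index bounds each inner integral.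
  have hsnd : ∫ p, (p.2.1 - G) * ((min (π.startRule T p.1.1 (rewards p.2))
        (π.pullsOne n p.1.1 (rewards p.1.2) (rewards p.2)) : ℕ) : ℝ) ∂(jointLaw ν v) ≤ 0 := by
    rw [jointLaw, integral_prod _ iM]
    refine integral_nonpos fun η => ?_
    refine integral_nonpos_of_nonAnticipating (f := fun y => min (π.startRule T η.1 y)
      (π.pullsOne n η.1 (rewards η.2) y)) hn ?_ ?_ ?_
    · exact ((π.measurable_startRule hT.measurable).comp measurable_prodMk_left).min
        (π.measurable_pullsOne n measurable_const measurable_const measurable_id)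
    · exact (π.nonAnticipating_startRule hT.nonAnticipating η.1).min
        (π.nonAnticipating_pulls η.1 _ n)
    · exact fun y => (min_le_left _ _).trans (π.startRule_le hT η.1 y)
  have hind : Integrable (fun η : unitInterval × ℝ × (ℕ → ℝ) => U.indicator 1 η.1 * (G - η.2.1))
      ((volume : Measure unitInterval).prod (armLaw (ν 0) (v 0))) :=
    (((integrable_const (1 : ℝ)).indicator hU).mul_prod
      ((integrable_const G).sub (integrable_fst_armLaw (ν 0) (v 0))))
  have hind' : Integrable (fun η : unitInterval × ℝ × (ℕ → ℝ) =>
      U.indicator 1 η.1 * max (η.2.1 - G) 0)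
      ((volume : Measure unitInterval).prod (armLaw (ν 0) (v 0))) :=
    (((integrable_const (1 : ℝ)).indicator hU).mul_prod
      ((integrable_fst_armLaw (ν 0) (v 0)).sub (integrable_const G)).pos_part)
  have hthd : (volume : Measure unitInterval).real U * ((G - ν 0) *
        (armLaw (ν 1) (v 1)).real {ω | T (rewards ω) = n}) - (n - 1) *
      ((volume : Measure unitInterval).real U *
        ∫ x, max (x - G) 0 ∂(gaussianReal (ν 0) (v 0))) ≤
      ∫ p, (G - p.1.2.1) * π.extraPulls n T p ∂(jointLaw ν v) := by
    have j1 : Integrable (fun p : (unitInterval × ℝ × (ℕ → ℝ)) × ℝ × (ℕ → ℝ) =>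
        (U.indicator 1 p.1.1 * (G - p.1.2.1)) * {ω | T (rewards ω) = n}.indicator 1 p.2)
        (jointLaw ν v) := hind.mul_prod ((integrable_const (1 : ℝ)).indicator hA)
    have j2 : Integrable (fun p : (unitInterval × ℝ × (ℕ → ℝ)) × ℝ × (ℕ → ℝ) =>
        ((n : ℝ) - 1) * (U.indicator 1 p.1.1 * max (p.1.2.1 - G) 0)) (jointLaw ν v) :=
      (hind'.comp_fst _).const_mul _
    have h := integral_mono (j1.sub j2) iD (π.extraPulls_mul_ge hT hn G)
    refine le_trans (le_of_eq ?_) h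
    have e1 : ∫ p : (unitInterval × ℝ × (ℕ → ℝ)) × ℝ × (ℕ → ℝ),
        (U.indicator 1 p.1.1 * (G - p.1.2.1)) * {ω | T (rewards ω) = n}.indicator 1 p.2
        ∂(jointLaw ν v) = (volume : Measure unitInterval).real U * ((G - ν 0) *
          (armLaw (ν 1) (v 1)).real {ω | T (rewards ω) = n}) := by
      rw [jointLaw, integral_prod_mul
        (fun η : unitInterval × ℝ × (ℕ → ℝ) => U.indicator 1 η.1 * (G - η.2.1))
        ({ω | T (rewards ω) = n}.indicator 1), hseed fun ω => G - ω.1,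
        integral_indicator_one hA, integral_sub (integrable_const _) (integrable_fst_armLaw _ _),
        integral_fst_armLaw]
      simp [mul_assoc]
    have e2 : ∫ p : (unitInterval × ℝ × (ℕ → ℝ)) × ℝ × (ℕ → ℝ),
        ((n : ℝ) - 1) * (U.indicator 1 p.1.1 * max (p.1.2.1 - G) 0) ∂(jointLaw ν v) =
        ((n : ℝ) - 1) * ((volume : Measure unitInterval).real U *
          ∫ x, max (x - G) 0 ∂(gaussianReal (ν 0) (v 0))) := by
      rw [integral_const_mul, jointLaw, integral_prod _ (hind'.comp_fst _)]
      simp only [integral_const, probReal_univ, one_smul]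
      rw [hseed fun ω => max (ω.1 - G) 0, ← map_fst_armLaw (ν 0) (v 0),
        integral_map measurable_fst.aemeasurable (by fun_prop)]
    rw [← e1, ← e2, ← integral_sub j1 j2]
    rfl
  rw [hsplit, hfst]
  linarith

end Strategy

theorem exp_neg_mul_log_le {c : ℝ} {n : ℕ} (hn : 1 ≤ n) (hc : 4 ≤ c) :
    Real.exp (-(c * Real.log n)) ≤ 1 / (n : ℝ) ^ 4 := by
  have hn0 : (0 : ℝ) < n := by exact_mod_cast hn
  have h1 : 0 ≤ Real.log n := Real.log_natCast_nonneg n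
  have h2 : Real.log ((n : ℝ) ^ 4) = 4 * Real.log n := by rw [Real.log_pow]; norm_num
  rw [Real.exp_neg, one_div]
  refine inv_anti₀ (by positivity) ?_
  rw [← Real.exp_log (show (0 : ℝ) < (n : ℝ) ^ 4 by positivity), h2]
  exact Real.exp_le_exp.2 (mul_le_mul_of_nonneg_right hc h1)

end Bandit

end

theorem theorem4 :
    ∃ c : ℝ, 0 < c ∧
      ∀ (n : ℕ) (ν : Fin 2 → ℝ) (v : Fin 2 → ℝ≥0) (π : Bandit.Strategy 2),
        1 ≤ n →
        π.IsBayesOptimal n (Bandit.gaussianPrior ν v) →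
        0 < π.probFirst 0 →
        Bandit.gittinsIndex (ν 1) (v 1) n ≤ ν 0 + Real.sqrt (2 * c * (v 0 : ℝ) * Real.log n) := by
  set K := min (Bandit.gaussianPosPart ^ 2 / 16) 1
  have hK : 0 < K := lt_min (by have := Bandit.gaussianPosPart_pos; positivity) one_pos
  have hlog2 : 0 < Real.log 2 := Real.log_pos one_lt_two
  -- The summand 4 makes the exponential tail at most `n⁻⁴`, enough for the factor `n - 1` against
  -- `K / n ^ 3`. The other summand gives `1 / (2 * c * log n) ≤ K` for `n ≥ 2`, absorbing the
  -- prefactor of the tail bound.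
  refine ⟨4 + 1 / (2 * K * Real.log 2), by positivity, ?_⟩
  intro n ν v π hn hopt hfirst
  set c := 4 + 1 / (2 * K * Real.log 2) with hc
  have hc4 : 4 ≤ c := by rw [hc, le_add_iff_nonneg_right]; positivity
  set G := Bandit.gittinsIndex (ν 1) (v 1) n
  by_contra! hlt
  have hlog : 0 ≤ Real.log n := Real.log_natCast_nonneg n
  have hΔ : ν 0 < G := lt_of_le_of_lt (le_add_of_nonneg_right (Real.sqrt_nonneg _)) hlt
  have hn0 : (0 : ℝ) < n := by exact_mod_cast hn
  have htail : ((n : ℝ) - 1) * ∫ x, max (x - G) 0 ∂(gaussianReal (ν 0) (v 0)) <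
      (G - ν 0) * (K / n ^ 3) := by
    -- For `n = 1` the logarithm vanishes, but so does the factor `n - 1` of the tail.
    rcases Nat.eq_or_lt_of_le hn with rfl | hn2
    · have : 0 < (G - ν 0) * K := mul_pos (sub_pos.2 hΔ) hK
      simpa using this
    have hn2' : (2 : ℝ) ≤ n := by exact_mod_cast hn2
    have hlogn : Real.log 2 ≤ Real.log n := Real.log_le_log two_pos hn2'
    have hL : 0 < 2 * c * Real.log n := by
      have := hlog2.trans_le hlogn
      positivity
    have hsq : (v 0 : ℝ) * (2 * c * Real.log n) ≤ (G - ν 0) ^ 2 := by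
      have h1 := (Real.sqrt_le_left (sub_pos.2 hΔ).le).1 (by linarith :
        √(2 * c * (v 0 : ℝ) * Real.log n) ≤ G - ν 0)
      linarith
    have h1 := Bandit.integral_max_sub_le (ν 0) (v 0) hL hΔ hsq
    have h2 : Real.exp (-(2 * c * Real.log n / 2)) ≤ 1 / (n : ℝ) ^ 4 := by
      have := Bandit.exp_neg_mul_log_le hn hc4
      rwa [show 2 * c * Real.log n / 2 = c * Real.log n by ring]
    have h3 : 1 ≤ K * (2 * c * Real.log n) := by
      have : 1 / (2 * K * Real.log 2) ≤ c := by rw [hc]; linarith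
      calc 1 = K * (2 * (1 / (2 * K * Real.log 2)) * Real.log 2) := by field_simp
        _ ≤ K * (2 * c * Real.log n) := by gcongr
    have h4 : (G - ν 0) / (2 * c * Real.log n) ≤ (G - ν 0) * K := by
      rw [div_le_iff₀ hL, mul_assoc]
      exact le_mul_of_one_le_right (sub_pos.2 hΔ).le h3
    have hGK : 0 < (G - ν 0) * K := mul_pos (sub_pos.2 hΔ) hK
    calc ((n : ℝ) - 1) * ∫ x, max (x - G) 0 ∂(gaussianReal (ν 0) (v 0))
        ≤ (n - 1) * ((G - ν 0) * K * (1 / (n : ℝ) ^ 4)) := by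
          refine mul_le_mul_of_nonneg_left (h1.trans ?_) (by linarith)
          exact mul_le_mul h4 h2 (Real.exp_pos _).le hGK.le
      _ < n * ((G - ν 0) * K * (1 / (n : ℝ) ^ 4)) :=
          mul_lt_mul_of_pos_right (by linarith) (by positivity)
      _ = (G - ν 0) * (K / n ^ 3) := by field_simp
  -- The tolerance is half of the gap in `htail`, so the gain of the modified strategy stays
  -- positive.
  obtain ⟨T, hT, hε, hp⟩ :=
    Bandit.exists_isRule_le_measureReal (ν 1) (v 1) hn (half_pos (sub_pos.2 htail))
  have hgain := π.le_integral_extraPulls hT hn ν v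
  rw [← π.bayesRegret_sub_exploreFirst hT ν v] at hgain
  have hopt' := hopt (π.exploreFirst (π.startRule T) (π.measurable_startRule hT.measurable))
  have hq : 0 < (volume : Measure unitInterval).real {u | π.act 0 u Fin.elim0 = 0} :=
    ENNReal.toReal_pos hfirst.ne' (measure_ne_top _ _)
  have hmul := mul_le_mul_of_nonneg_left hp (sub_pos.2 hΔ).le
  have hpos := mul_pos hq (show 0 < (∫ ω, (ω.1 - G) * (T (Bandit.rewards ω) : ℝ)
      ∂(Bandit.armLaw (ν 1) (v 1))) +
    (G - ν 0) * (Bandit.armLaw (ν 1) (v 1)).real {ω | T (Bandit.rewards ω) = n} -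
    (n - 1) * ∫ x, max (x - G) 0 ∂(gaussianReal (ν 0) (v 0)) by linarith)
  linarith
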